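/- Call an $n\times n$ real random matrix $G=(\xi_{ij})$ a Ginibre matrix if its $n^2$ entries are independent, and call a real random matrix $W=(\xi_{ij})$ a Wigner matrix if it is almost surely symmetric and the entries $\xi_{ij}$, $1\le i\le j\le n$, are independent. The entries need not be identically distributed, their laws may depend on $n$, and no moment assumptions are made. For such a matrix let $$\kappa_n=\max_{1\le i,j\le n}\ \sup_{x\in\mathbb R}\ \mathbb P\{\xi_{ij}=x\}$$ be the mass of the largest atom among the laws of its entries. Let $\kappa\in[0,1)$. (a) There is a constant $C=C(\kappa)>0$, depending only on $\kappa$, such that for every $n\ge 1$ and every $n\times n$ Ginibre matrix $G$ with $\kappa_n<\kappa$, $$\mathbb P\{\operatorname{rank}(G)<n\}\le C\,n^{-1/2}.$$ (b) For every $\varepsilon\in(0,1)$ there is a constant $C=C(\varepsilon,\kappa)>0$, depending only on $\varepsilon$ and $\kappa$, such that for every $n\ge 1$ and every $n\times n$ Wigner matrix $W$ with $\kappa_n<\kappa$, $$\mathbb P\{\operatorname{rank}(W)<n\}\le C\,n^{-(1-\varepsilon)/4}.$$ -/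

import Mathlib

open MeasureTheory ProbabilityTheory

universe u

/-- An `n × n` real random matrix is a Ginibre matrix if its `n²` entries are independent
random variables (not necessarily identically distributed, no moment assumption). -/
structure IsGinibreMatrix {Ω : Type*} [MeasurableSpace Ω] {n : ℕ} (μ : Measure Ω)
    (A : Ω → Matrix (Fin n) (Fin n) ℝ) : Prop where
  measurable_entry : ∀ i j : Fin n, Measurable (fun ω => A ω i j)
  indep : iIndepFun (fun (p : Fin n × Fin n) (ω : Ω) => A ω p.1 p.2) μ

/-- An `n × n` real random matrix is a Wigner matrix if it is (almost surely) symmetric and its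
entries on and above the diagonal are independent random variables (not necessarily identically
distributed, no moment assumption). -/
structure IsWignerMatrix {Ω : Type*} [MeasurableSpace Ω] {n : ℕ} (μ : Measure Ω)
    (A : Ω → Matrix (Fin n) (Fin n) ℝ) : Prop where
  measurable_entry : ∀ i j : Fin n, Measurable (fun ω => A ω i j)
  symm : ∀ᵐ ω ∂μ, (A ω).IsSymm
  indep : iIndepFun
    (fun (p : {p : Fin n × Fin n // p.1 ≤ p.2}) (ω : Ω) => A ω p.1.1 p.1.2) μ

/-- The biggest jump of the distribution function of a real random variable `X`, that is, the
mass `sup_x ℙ(X = x)` of its largest atom (`0` if there is no atom). -/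
noncomputable def biggestJump {Ω : Type*} [MeasurableSpace Ω] (μ : Measure Ω)
    (X : Ω → ℝ) : ℝ :=
  ⨆ x : ℝ, μ.real {ω | X ω = x}

/-- The maximum over all entries of a random matrix of the biggest jump of the entry. -/
noncomputable def matrixBiggestJump {Ω : Type*} [MeasurableSpace Ω] {n : ℕ} (μ : Measure Ω)
    (A : Ω → Matrix (Fin n) (Fin n) ℝ) : ℝ :=
  ⨆ p : Fin n × Fin n, biggestJump μ (fun ω => A ω p.1 p.2)

/-!
Both parts rest on the Littlewood–Offord inequality for independent variables whose atoms have mass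
at most `κ < 1`: a linear form with `k` nonzero coefficients hits a given value with probability
`O(k ^ (-1/2))` (`exists_measure_sum_eq_le`). No moments are needed. Each variable is replaced by a
random choice between two independent samples, which differ with probability at least `1 - κ`;
given the samples, the sum is a signed sum, to which Sperner's theorem applies. For the inequality
to give powers of `n`, kernel vectors must not be sparse. A tall random matrix has full column rank
up to an exponentially small probability (`measure_exists_ker_le`), because each new row lowers the
dimension of what is left of the kernel with probability at least `1 - κ`. A union bound over the
supports of size `n / L` then excludes sparse kernel vectors.

For independent entries (`measure_exists_left_ker_le`), singularity means a linear dependence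
between the rows. It has at least `n / L` nonzero coefficients, so at least `n / L` rows lie in the
span of the others. A given row does so with probability `O(n ^ (-1/2))`, since it must be
orthogonal to a vector determined by the other rows, which is not sparse. Markov's inequality
concludes.

For symmetric matrices, the leading minors are revealed one after the other. If a minor is singular,
the next column is orthogonal to a given kernel vector only with probability `O(m ^ (-1/2))`;
otherwise the nullity drops by one (`nullity_border_lt`). If the minor `M` is nonsingular, the next
minor is singular only if the corner equals the value of the quadratic form of `M⁻¹` at the new
column. All rows of `M⁻¹` have at least `m / L` nonzero entries, since a sparse row would be a
sparse vector mapped by `M` to a basis vector. Splitting the variables into two groups and resampling one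
of them turns the quadratic event into a linear one, at the cost of a square root, so that its
probability is `O(m ^ (-1/4))` (`exists_measure_quadratic_eq_le`). These
three facts make the expectation of `b ^ nullity - 1`, with `b > 1` close to `1`, satisfy a
contracting recursion with a source of order `m ^ (-1/4)`
(`exists_lintegral_potential_nullity_le`). The resulting bound `O(n ^ (-1/4))` is stronger than
the bound `O(n ^ (-(1 - ε) / 4))` claimed.
-/

/-! ### The Littlewood–Offord inequality -/

lemma centralBinom_sq_mul_le (n : ℕ) : n.centralBinom ^ 2 * (2 * n + 1) ≤ 16 ^ n := by
  induction n with
  | zero => simp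
  | succ n ih =>
    have h := Nat.succ_mul_centralBinom_succ n
    have h2 : (n + 1) ^ 2 * ((n + 1).centralBinom ^ 2 * (2 * (n + 1) + 1)) ≤
        (n + 1) ^ 2 * 16 ^ (n + 1) := by
      calc (n + 1) ^ 2 * ((n + 1).centralBinom ^ 2 * (2 * (n + 1) + 1))
          = ((n + 1) * (n + 1).centralBinom) ^ 2 * (2 * n + 3) := by ring
        _ = (4 * (2 * n + 1) * (2 * n + 3)) * (n.centralBinom ^ 2 * (2 * n + 1)) := by
          rw [h]; ring
        _ ≤ (16 * (n + 1) ^ 2) * 16 ^ n := by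
          apply Nat.mul_le_mul _ ih
          nlinarith
        _ = _ := by ring
    exact Nat.le_of_mul_le_mul_left h2 (by positivity)

lemma choose_half_sq_mul_le (N : ℕ) : (N.choose (N / 2)) ^ 2 * (N + 1) ≤ 4 ^ N := by
  rcases Nat.even_or_odd' N with ⟨n, rfl | rfl⟩
  · have h := centralBinom_sq_mul_le n
    rw [Nat.centralBinom] at h
    rw [Nat.mul_div_cancel_left n two_pos, pow_mul]
    exact h
  · have h := centralBinom_sq_mul_le (n + 1)
    have h2 : (n + 1).centralBinom = 2 * (2 * n + 1).choose n := by
      rw [Nat.centralBinom, show 2 * (n + 1) = (2 * n + 1) + 1 by ring, Nat.choose_succ_succ,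
        Nat.choose_symm_half]
      ring
    rw [show (2 * n + 1) / 2 = n by omega]
    rw [h2] at h
    have e : 16 ^ (n + 1) = 4 * 4 ^ (2 * n + 1) := by
      rw [show (16 : ℕ) = 4 ^ 2 by norm_num, ← pow_mul, ← pow_succ']; ring
    rw [e] at h
    nlinarith [Nat.zero_le (((2 * n + 1).choose n) ^ 2)]

/-- Erdős' form of the Littlewood–Offord inequality, a consequence of Sperner's theorem: after
flipping the signs of the negative weights, subsets with equal weight form an antichain. -/
lemma card_sum_eq_le_of_ne_zero {α : Type*} [Fintype α] [DecidableEq α] (b : α → ℝ)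
    (hb : ∀ i, b i ≠ 0) (c : ℝ) :
    (Finset.univ.filter fun s : Finset α => ∑ i ∈ s, b i = c).card ≤
      (Fintype.card α).choose (Fintype.card α / 2) := by
  set P : Finset α := Finset.univ.filter fun i => b i < 0 with hP
  set A := Finset.univ.filter fun s : Finset α => ∑ i ∈ s, b i = c with hA
  have hinj : Function.Injective fun s : Finset α => symmDiff s P := symmDiff_left_injective P
  have key : ∀ s : Finset α, ∑ i ∈ symmDiff s P, |b i| = ∑ i ∈ s, b i - ∑ i ∈ P, b i := by
    intro s
    have e : ∀ (u : Finset α) (f : α → ℝ), ∑ i ∈ u, f i = ∑ i, if i ∈ u then f i else 0 := by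
      intro u f; simp
    rw [e, e s, e P, ← Finset.sum_sub_distrib]
    refine Finset.sum_congr rfl fun i _ => ?_
    have hiP : i ∈ P ↔ b i < 0 := by simp [hP]
    simp only [Finset.mem_symmDiff, hiP]
    by_cases h1 : i ∈ s <;> by_cases h2 : b i < 0 <;> simp [h1, h2]
    · exact not_lt.mp h2
    · exact h2.le
  rw [← Finset.card_image_of_injective A hinj]
  apply IsAntichain.sperner
  intro x hx y hy hxy hsub
  simp only [Finset.coe_image, Set.mem_image, Finset.mem_coe, hA, Finset.mem_filter,
    Finset.mem_univ, true_and] at hx hy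
  obtain ⟨s, hs, rfl⟩ := hx
  obtain ⟨t, ht, rfl⟩ := hy
  have h1 := key s
  have h2 := key t
  rw [hs] at h1
  rw [ht] at h2
  obtain ⟨i, hi, hi'⟩ := Finset.exists_of_ssubset (Finset.ssubset_iff_subset_ne.mpr ⟨hsub, hxy⟩)
  have := Finset.sum_lt_sum_of_subset hsub hi hi' (abs_pos.mpr (hb i))
    (fun j _ _ => abs_nonneg (b j))
  linarith

lemma card_sum_eq_le {ι : Type*} [Fintype ι] [DecidableEq ι] (b : ι → ℝ) (c : ℝ) :
    ((Finset.univ.filter fun s : Finset ι => ∑ i ∈ s, b i = c).card : ℝ) ≤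
      2 ^ Fintype.card ι * (1 / √((Finset.univ.filter fun i => b i ≠ 0).card + 1)) := by
  set N := (Finset.univ.filter fun i => b i ≠ 0).card with hN
  have hNc : Fintype.card {i // b i ≠ 0} = N := Fintype.card_subtype _
  have hZc : Fintype.card {i // b i = 0} + N = Fintype.card ι := by
    rw [hN, Fintype.card_subtype, Finset.card_filter_add_card_filter_not, Finset.card_univ]
  have h1 : (Finset.univ.filter fun s : Finset ι => ∑ i ∈ s, b i = c).card ≤
      2 ^ Fintype.card {i // b i = 0} * N.choose (N / 2) := by
    have h := card_sum_eq_le_of_ne_zero (fun i : {i // b i ≠ 0} => b i) (fun i => i.2) c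
    rw [hNc] at h
    refine le_trans ?_ (Nat.mul_le_mul_left _ h)
    rw [← Fintype.card_finset, ← Finset.card_univ, ← Finset.card_product]
    refine Finset.card_le_card_of_injOn
      (fun s => (s.subtype (fun i => b i = 0), s.subtype (fun i => b i ≠ 0))) ?_ ?_
    · intro s hs
      simp only [Finset.coe_filter, Finset.mem_univ, true_and, Set.mem_ofPred_eq] at hs
      simp only [Finset.coe_product, Set.mem_prod, Finset.coe_univ, Set.mem_univ, true_and,
        Finset.coe_filter, Finset.mem_univ, Set.mem_ofPred_eq]
      rw [Finset.sum_subtype_eq_sum_filter, Finset.sum_filter_ne_zero, hs]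
    · intro s _ t _ hst
      simp only [Prod.mk.injEq] at hst
      ext i
      by_cases hi : b i = 0
      · have := congrArg (fun u => (⟨i, hi⟩ : {i // b i = 0}) ∈ u) hst.1
        simpa using this
      · have := congrArg (fun u => (⟨i, hi⟩ : {i // b i ≠ 0}) ∈ u) hst.2
        simpa using this
  have h2 : ((N.choose (N / 2) : ℕ) : ℝ) ≤ 2 ^ N * (1 / √(N + 1)) := by
    have h := choose_half_sq_mul_le N
    have h' : ((N.choose (N / 2) : ℕ) : ℝ) ^ 2 * (N + 1) ≤ 4 ^ N := by exact_mod_cast h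
    have hs : 0 < √((N : ℝ) + 1) := Real.sqrt_pos.mpr (by positivity)
    rw [mul_one_div, le_div_iff₀ hs]
    apply le_of_sq_le_sq _ (by positivity)
    rw [mul_pow, Real.sq_sqrt (by positivity), ← pow_mul, mul_comm N 2, pow_mul]
    norm_num
    exact h'
  calc ((Finset.univ.filter fun s : Finset ι => ∑ i ∈ s, b i = c).card : ℝ)
      ≤ 2 ^ Fintype.card {i // b i = 0} * N.choose (N / 2) := by exact_mod_cast h1
    _ ≤ 2 ^ Fintype.card {i // b i = 0} * (2 ^ N * (1 / √(N + 1))) := by gcongr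
    _ = _ := by rw [← hZc, pow_add]; ring

lemma exists_mul_pow_le {q : ℝ} (h0 : 0 ≤ q) (h1 : q < 1) :
    ∃ K : ℝ, 0 < K ∧ ∀ k : ℕ, k * q ^ k ≤ K := by
  have h := tendsto_self_mul_const_pow_of_abs_lt_one (r := q) (by rwa [abs_of_nonneg h0])
  obtain ⟨K, hK⟩ := h.bddAbove_range
  exact ⟨max K 1, by positivity, fun k => (hK ⟨k, rfl⟩).trans (le_max_left _ _)⟩

lemma exists_pow_le_div_sqrt {q : ℝ} (h0 : 0 ≤ q) (h1 : q < 1) :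
    ∃ K : ℝ, 0 < K ∧ ∀ k : ℕ, 1 ≤ k → q ^ k ≤ K / √k := by
  obtain ⟨K, hK, h⟩ := exists_mul_pow_le h0 h1
  refine ⟨K, hK, fun k hk => ?_⟩
  have hk' : (1 : ℝ) ≤ k := by exact_mod_cast hk
  rw [le_div_iff₀ (by positivity), mul_comm]
  refine le_trans ?_ (h k)
  gcongr
  rw [Real.sqrt_le_left (by positivity)]
  nlinarith

/-- Two independent samples of a law whose atoms have mass at most `κ` coincide with
probability at most `κ`. -/
lemma prod_diagonal_le {ν : Measure ℝ} [IsProbabilityMeasure ν] {κ : ENNReal}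
    (h : ∀ x, ν {x} ≤ κ) : (ν.prod ν) {z | z.1 = z.2} ≤ κ := by
  have hm : MeasurableSet {z : ℝ × ℝ | z.1 = z.2} :=
    measurableSet_eq_fun measurable_fst measurable_snd
  rw [Measure.prod_apply hm]
  calc ∫⁻ x, ν (Prod.mk x ⁻¹' {z : ℝ × ℝ | z.1 = z.2}) ∂ν ≤ ∫⁻ _, κ ∂ν := by
        refine lintegral_mono fun x => ?_
        refine le_trans (measure_mono ?_) (h x)
        intro y hy
        exact hy.symm
    _ = κ := by simp

/-- Choosing in each coordinate one of two independent samples, according to a fixed set `s` of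
coordinates, does not change the product law. -/
lemma measurePreserving_mix {ι : Type*} [Fintype ι] [DecidableEq ι] (ν : ι → Measure ℝ)
    [∀ i, IsProbabilityMeasure (ν i)] (s : Finset ι) :
    MeasurePreserving (fun (z : ι → ℝ × ℝ) i => if i ∈ s then (z i).1 else (z i).2)
      (Measure.pi fun i => (ν i).prod (ν i)) (Measure.pi ν) := by
  refine measurePreserving_pi (fun i => (ν i).prod (ν i)) ν
    (f := fun i (p : ℝ × ℝ) => if i ∈ s then p.1 else p.2) fun i => ?_
  by_cases hi : i ∈ s
  · simpa [hi] using measurePreserving_fst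
  · simpa [hi] using measurePreserving_snd

/-- The number of nonzero signs left to randomise in the two-sample form of a weighted sum. -/
noncomputable def activeCount {ι : Type*} [Fintype ι] (a : ι → ℝ) (z : ι → ℝ × ℝ) : ℕ :=
  (Finset.univ.filter fun i => a i * ((z i).1 - (z i).2) ≠ 0).card

/-- Averaging over all ways to mix two independent samples reduces the concentration of the sum to
that of a signed sum with the samples fixed. -/
lemma pi_sum_eq_le_lintegral {ι : Type*} [Fintype ι] (ν : ι → Measure ℝ)
    [∀ i, IsProbabilityMeasure (ν i)] (a : ι → ℝ) (c : ℝ) :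
    Measure.pi ν {x | ∑ i, a i * x i = c} ≤
      ∫⁻ z, ENNReal.ofReal (1 / √(activeCount a z + 1))
        ∂(Measure.pi fun i => (ν i).prod (ν i)) := by
  classical
  set A : Set (ι → ℝ) := {x | ∑ i, a i * x i = c} with hA
  have hAm : MeasurableSet A := measurableSet_eq_fun (by fun_prop) measurable_const
  set ρ := Measure.pi fun i => (ν i).prod (ν i)
  let T : Finset ι → (ι → ℝ × ℝ) → (ι → ℝ) := fun s z i => if i ∈ s then (z i).1 else (z i).2
  have hT : ∀ s, MeasurePreserving (T s) ρ (Measure.pi ν) := measurePreserving_mix ν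
  have h1 : (2 ^ Fintype.card ι : ENNReal) * Measure.pi ν A =
      ∫⁻ z, ∑ s : Finset ι, A.indicator 1 (T s z) ∂ρ := by
    rw [lintegral_finsetSum]
    · have : ∀ s : Finset ι, ∫⁻ z, A.indicator 1 (T s z) ∂ρ = Measure.pi ν A := by
        intro s
        rw [(hT s).lintegral_comp (f := A.indicator 1) (measurable_one.indicator hAm),
          lintegral_indicator_one hAm]
      simp [this, Fintype.card_finset]
    · intro s _
      exact (measurable_one.indicator hAm).comp (hT s).measurable
  have h2 : ∀ z, ∑ s : Finset ι, A.indicator (1 : (ι → ℝ) → ENNReal) (T s z) ≤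
      2 ^ Fintype.card ι * ENNReal.ofReal (1 / √(activeCount a z + 1)) := by
    intro z
    have h3 := card_sum_eq_le (fun i => a i * ((z i).1 - (z i).2)) (c - ∑ i, a i * (z i).2)
    have h4 : ∑ s : Finset ι, A.indicator (1 : (ι → ℝ) → ENNReal) (T s z) =
        ((Finset.univ.filter fun s : Finset ι =>
          ∑ i ∈ s, a i * ((z i).1 - (z i).2) = c - ∑ i, a i * (z i).2).card : ENNReal) := by
      rw [Finset.card_filter, Nat.cast_sum]
      refine Finset.sum_congr rfl fun s _ => ?_
      have e : T s z ∈ A ↔ ∑ i ∈ s, a i * ((z i).1 - (z i).2) = c - ∑ i, a i * (z i).2 := by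
        have : ∑ i, a i * T s z i =
            ∑ i ∈ s, a i * ((z i).1 - (z i).2) + ∑ i, a i * (z i).2 := by
          have e : ∀ f : ι → ℝ, ∑ i ∈ s, f i = ∑ i, if i ∈ s then f i else 0 := by
            intro f; simp
          rw [e, ← Finset.sum_add_distrib]
          refine Finset.sum_congr rfl fun i _ => ?_
          by_cases hi : i ∈ s
          · simp only [T, hi, if_true]; ring
          · simp [T, hi]
        rw [hA, Set.mem_ofPred_eq, this]
        constructor <;> intro h <;> linarith
      by_cases h : T s z ∈ A
      · rw [Set.indicator_of_mem h, if_pos (e.mp h)]; simp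
      · rw [Set.indicator_of_notMem h, if_neg (fun h' => h (e.mpr h'))]; simp
    rw [h4, ← ENNReal.ofReal_natCast]
    refine (ENNReal.ofReal_le_ofReal h3).trans ?_
    rw [ENNReal.ofReal_mul (by positivity)]
    gcongr
    · rw [ENNReal.ofReal_pow (by norm_num)]; simp
    · rfl
  have h5 : (2 ^ Fintype.card ι : ENNReal) * Measure.pi ν A ≤ 2 ^ Fintype.card ι *
      ∫⁻ z, ENNReal.ofReal (1 / √(activeCount a z + 1)) ∂ρ := by
    rw [h1, ← lintegral_const_mul' _ _ (by simp)]
    exact lintegral_mono h2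
  exact (ENNReal.mul_le_mul_iff_right (by simp) (by simp)).mp h5

/-- Exponential moment bound showing that few active signs are exponentially unlikely. -/
lemma lintegral_half_pow_activeCount_le {ι : Type*} [Fintype ι] {ν : ι → Measure ℝ}
    [∀ i, IsProbabilityMeasure (ν i)] {κ : ℝ} (hκ0 : 0 ≤ κ)
    (hκ : ∀ i x, ν i {x} ≤ ENNReal.ofReal κ) (hκ1 : κ < 1) (a : ι → ℝ) {k : ℕ}
    (hk : k ≤ (Finset.univ.filter fun i => a i ≠ 0).card) :
    ∫⁻ z, ENNReal.ofReal ((1 / 2) ^ activeCount a z) ∂(Measure.pi fun i => (ν i).prod (ν i)) ≤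
      ENNReal.ofReal (((1 + κ) / 2) ^ k) := by
  classical
  let g : ι → ℝ × ℝ → ENNReal := fun i p =>
    if a i * (p.1 - p.2) ≠ 0 then ENNReal.ofReal (1 / 2) else 1
  have hgm : ∀ i, Measurable (g i) := fun i =>
    Measurable.ite (measurableSet_eq_fun (by fun_prop) measurable_const).compl
      measurable_const measurable_const
  have h1 : ∀ z : ι → ℝ × ℝ, ENNReal.ofReal ((1 / 2) ^ activeCount a z) = ∏ i, g i (z i) := by
    intro z
    rw [activeCount, Finset.prod_ite, Finset.prod_const, Finset.prod_const_one, mul_one,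
      ENNReal.ofReal_pow (by norm_num)]
  have h2 : ∀ i, ∫⁻ p, g i p ∂((ν i).prod (ν i)) ≤
      if a i ≠ 0 then ENNReal.ofReal ((1 + κ) / 2) else 1 := by
    intro i
    by_cases hi : a i = 0
    · simp [g, hi]
    · rw [if_pos hi]
      have : ∀ p : ℝ × ℝ, g i p = ENNReal.ofReal (1 / 2) +
          ENNReal.ofReal (1 / 2) * ({z : ℝ × ℝ | z.1 = z.2}.indicator 1 p) := by
        intro p
        by_cases hp : p.1 = p.2
        · have : p ∈ {z : ℝ × ℝ | z.1 = z.2} := hp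
          rw [Set.indicator_of_mem this]
          simp only [g, hp, sub_self, mul_zero, ne_eq, not_true_eq_false, if_false, Pi.one_apply,
            mul_one]
          rw [← ENNReal.ofReal_add (by norm_num) (by norm_num)]
          norm_num
        · have : p ∉ {z : ℝ × ℝ | z.1 = z.2} := hp
          rw [Set.indicator_of_notMem this]
          simp [g, hi, sub_eq_zero, hp]
      have hm : MeasurableSet {z : ℝ × ℝ | z.1 = z.2} :=
        measurableSet_eq_fun measurable_fst measurable_snd
      simp_rw [this]
      rw [lintegral_add_left measurable_const, lintegral_const_mul _ (measurable_one.indicator hm),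
        lintegral_indicator_one hm]
      simp only [lintegral_const, measure_univ, mul_one]
      calc _ ≤ ENNReal.ofReal (1 / 2) + ENNReal.ofReal (1 / 2) * ENNReal.ofReal κ := by
            gcongr; exact prod_diagonal_le (hκ i)
        _ = _ := by
            rw [← ENNReal.ofReal_mul (by norm_num), ← ENNReal.ofReal_add (by norm_num)
              (by positivity)]
            congr 1; ring
  simp_rw [h1]
  have hind := iIndepFun_pi (μ := fun i => (ν i).prod (ν i)) (X := g)
    (fun i => (hgm i).aemeasurable)
  have hprod := lintegral_prod_eq_prod_lintegral_of_indepFun Finset.univ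
    (fun i (z : ι → ℝ × ℝ) => g i (z i)) hind
    (fun i => (hgm i).comp (measurable_pi_apply i))
  rw [hprod]
  calc ∏ i, ∫⁻ z : ι → ℝ × ℝ, g i (z i) ∂(Measure.pi fun i => (ν i).prod (ν i))
      = ∏ i, ∫⁻ p, g i p ∂((ν i).prod (ν i)) := by
        refine Finset.prod_congr rfl fun i _ => ?_
        exact (measurePreserving_eval (fun i => (ν i).prod (ν i)) i).lintegral_comp (hgm i)
    _ ≤ ∏ i, (if a i ≠ 0 then ENNReal.ofReal ((1 + κ) / 2) else 1) :=
        Finset.prod_le_prod' fun i _ => h2 i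
    _ = ENNReal.ofReal ((1 + κ) / 2) ^ (Finset.univ.filter fun i => a i ≠ 0).card := by
        rw [Finset.prod_ite, Finset.prod_const, Finset.prod_const_one, mul_one]
    _ ≤ ENNReal.ofReal ((1 + κ) / 2) ^ k := by
        refine pow_le_pow_right_of_le_one' ?_ hk
        rw [ENNReal.ofReal_le_one]; linarith
    _ = _ := by rw [ENNReal.ofReal_pow (by positivity)]

/-- The Littlewood–Offord inequality for independent random variables without moments: a weighted
sum with at least `k` nonzero weights hits a given value with probability `O(k ^ (-1/2))`. Only an
upper bound `κ < 1` for the masses of the atoms enters the constant. -/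
theorem exists_pi_sum_eq_le {κ : ℝ} (hκ0 : 0 ≤ κ) (hκ1 : κ < 1) :
    ∃ C : ℝ, 0 < C ∧ ∀ {ι : Type} [Fintype ι] (ν : ι → Measure ℝ)
      [∀ i, IsProbabilityMeasure (ν i)], (∀ i x, ν i {x} ≤ ENNReal.ofReal κ) →
      ∀ (a : ι → ℝ) (c : ℝ) (k : ℕ), 1 ≤ k → k ≤ (Finset.univ.filter fun i => a i ≠ 0).card →
        Measure.pi ν {x | ∑ i, a i * x i = c} ≤ ENNReal.ofReal (C / √k) := by
  set θ : ℝ := (1 + κ) / 2 with hθ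
  have hθ0 : 0 < θ := by positivity
  have hθ1 : θ < 1 := by rw [hθ]; linarith
  set t : ℝ := √θ with ht
  have ht0 : 0 < t := Real.sqrt_pos.mpr hθ0
  have htt : t * t = θ := Real.mul_self_sqrt hθ0.le
  have ht1 : t < 1 := by nlinarith
  -- `t ^ 2 = θ` leaves a factor `t ^ k` after the exponential Markov bound
  obtain ⟨J, hJ⟩ := exists_pow_lt_of_lt_one (show (0 : ℝ) < 1 / 2 by norm_num) ht1
  obtain ⟨K, hK0, hK⟩ := exists_pow_le_div_sqrt ht0.le ht1
  refine ⟨√J + K, by positivity, ?_⟩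
  intro ι _ ν _ hν a c k hk1 hk
  have hkR : (0 : ℝ) < k := by exact_mod_cast hk1
  refine (pi_sum_eq_le_lintegral ν a c).trans ?_
  -- either `k / J` signs are active, or the factor `2 ^ (-activeCount)` is large
  have key : ∀ z : ι → ℝ × ℝ, ENNReal.ofReal (1 / √(activeCount a z + 1)) ≤
      ENNReal.ofReal (√J / √k) +
        ENNReal.ofReal (t⁻¹ ^ k) * ENNReal.ofReal ((1 / 2) ^ activeCount a z) := by
    intro z
    rw [← ENNReal.ofReal_mul (by positivity), ← ENNReal.ofReal_add (by positivity)
      (by positivity)]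
    refine ENNReal.ofReal_le_ofReal ?_
    set N := activeCount a z
    by_cases h : k ≤ J * (N + 1)
    · have h' : (k : ℝ) ≤ J * (N + 1) := by exact_mod_cast h
      have : 1 / √((N : ℝ) + 1) ≤ √J / √k := by
        rw [div_le_div_iff₀ (by positivity) (by positivity), one_mul,
          ← Real.sqrt_mul (by positivity)]
        exact Real.sqrt_le_sqrt h'
      have : 0 ≤ t⁻¹ ^ k * (1 / 2) ^ N := by positivity
      linarith
    · have h1 : 1 / √((N : ℝ) + 1) ≤ 1 := by
        rw [div_le_one (by positivity), Real.one_le_sqrt]; simp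
      have h2 : 1 ≤ t⁻¹ ^ k * (1 / 2) ^ N := by
        rw [inv_pow, ← div_eq_inv_mul, one_le_div (by positivity)]
        calc t ^ k ≤ t ^ (J * N) := pow_le_pow_of_le_one ht0.le ht1.le (by nlinarith)
          _ = (t ^ J) ^ N := pow_mul _ _ _
          _ ≤ (1 / 2) ^ N := by gcongr
      have : 0 ≤ √(J : ℝ) / √k := by positivity
      linarith
  calc _ ≤ ∫⁻ z, (ENNReal.ofReal (√J / √k) +
        ENNReal.ofReal (t⁻¹ ^ k) * ENNReal.ofReal ((1 / 2) ^ activeCount a z))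
          ∂(Measure.pi fun i => (ν i).prod (ν i)) := lintegral_mono key
    _ = ENNReal.ofReal (√J / √k) + ENNReal.ofReal (t⁻¹ ^ k) *
        ∫⁻ z, ENNReal.ofReal ((1 / 2) ^ activeCount a z)
          ∂(Measure.pi fun i => (ν i).prod (ν i)) := by
      rw [lintegral_add_left measurable_const, lintegral_const_mul' _ _ ENNReal.ofReal_ne_top]
      simp
    _ ≤ ENNReal.ofReal (√J / √k) + ENNReal.ofReal (t⁻¹ ^ k) * ENNReal.ofReal (θ ^ k) := by
      gcongr
      exact lintegral_half_pow_activeCount_le hκ0 hν hκ1 a hk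
    _ = ENNReal.ofReal (√J / √k + t ^ k) := by
      rw [← ENNReal.ofReal_mul (by positivity), ← ENNReal.ofReal_add (by positivity)
        (by positivity), ← mul_pow, ← htt, inv_mul_cancel_left₀ ht0.ne']
    _ ≤ _ := by
      refine ENNReal.ofReal_le_ofReal ?_
      rw [add_div]
      have := hK k hk1
      linarith

/-! ### Conditioning on independent blocks -/

section Independence

variable {Ω : Type*} [MeasurableSpace Ω] {μ : Measure Ω}

lemma iIndepFun.indepFun_tuple {I J K : Type*} [Fintype J] [Fintype K] {X : I → Ω → ℝ}
    (h : iIndepFun X μ) (hm : ∀ i, Measurable (X i)) (f : J → I) (g : K → I)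
    (hfg : ∀ j k, f j ≠ g k) :
    IndepFun (fun ω j => X (f j) ω) (fun ω k => X (g k) ω) μ := by
  classical
  have hd : Disjoint (Finset.univ.image f) (Finset.univ.image g) := by
    rw [Finset.disjoint_left]
    intro i hi hi'
    simp only [Finset.mem_image, Finset.mem_univ, true_and] at hi hi'
    obtain ⟨j, rfl⟩ := hi
    obtain ⟨k, hk⟩ := hi'
    exact hfg j k hk.symm
  have h1 := h.indepFun_finset _ _ hd hm
  exact h1.comp (φ := fun x (j : J) => x ⟨f j, Finset.mem_image_of_mem f (Finset.mem_univ j)⟩)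
    (ψ := fun x (k : K) => x ⟨g k, Finset.mem_image_of_mem g (Finset.mem_univ k)⟩)
    (by fun_prop) (by fun_prop)

variable {α β : Type*} [MeasurableSpace α] [MeasurableSpace β] [IsProbabilityMeasure μ]

lemma lintegral_indepFun {U : Ω → α} {Y : Ω → β} (h : IndepFun U Y μ) (hU : Measurable U)
    (hY : Measurable Y) {f : α × β → ENNReal} (hf : Measurable f) :
    ∫⁻ ω, f (U ω, Y ω) ∂μ = ∫⁻ ω, ∫⁻ ω', f (U ω, Y ω') ∂μ ∂μ := by
  have h1 := (indepFun_iff_map_prod_eq_prod_map_map hU.aemeasurable hY.aemeasurable).mp h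
  have := Measure.isProbabilityMeasure_map (μ := μ) hU.aemeasurable
  have := Measure.isProbabilityMeasure_map (μ := μ) hY.aemeasurable
  calc ∫⁻ ω, f (U ω, Y ω) ∂μ = ∫⁻ p, f p ∂(μ.map fun ω => (U ω, Y ω)) :=
        (lintegral_map hf (hU.prodMk hY)).symm
    _ = ∫⁻ u, ∫⁻ y, f (u, y) ∂(μ.map Y) ∂(μ.map U) := by
        rw [h1, lintegral_prod _ hf.aemeasurable]
    _ = ∫⁻ ω, ∫⁻ y, f (U ω, y) ∂(μ.map Y) ∂μ :=
        lintegral_map (Measurable.lintegral_prod_right' hf) hU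
    _ = _ := by
        refine lintegral_congr fun ω => ?_
        exact lintegral_map (hf.comp measurable_prodMk_left) hY

lemma measure_indepFun {U : Ω → α} {Y : Ω → β} (h : IndepFun U Y μ) (hU : Measurable U)
    (hY : Measurable Y) {A : Set (α × β)} (hA : MeasurableSet A) :
    μ {ω | (U ω, Y ω) ∈ A} = ∫⁻ ω, μ {ω' | (U ω, Y ω') ∈ A} ∂μ := by
  have h1 := lintegral_indepFun h hU hY (f := A.indicator 1) (measurable_one.indicator hA)
  have h2 : ∫⁻ ω, A.indicator 1 (U ω, Y ω) ∂μ = μ {ω | (U ω, Y ω) ∈ A} :=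
    lintegral_indicator_one (μ := μ) (s := {ω | (U ω, Y ω) ∈ A}) ((hU.prodMk hY) hA)
  rw [← h2, h1]
  refine lintegral_congr fun ω => ?_
  exact lintegral_indicator_one (μ := μ) (s := {ω' | (U ω, Y ω') ∈ A})
    ((measurable_const.prodMk hY) hA)

lemma measure_indepFun_le {U : Ω → α} {Y : Ω → β} (h : IndepFun U Y μ) (hU : Measurable U)
    (hY : Measurable Y) {A : Set (α × β)} (hA : MeasurableSet A) {p : ENNReal}
    (hp : ∀ u, μ {ω' | (u, Y ω') ∈ A} ≤ p) :
    μ {ω | (U ω, Y ω) ∈ A} ≤ p := by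
  rw [measure_indepFun h hU hY hA]
  calc _ ≤ ∫⁻ _, p ∂μ := lintegral_mono fun ω => hp _
    _ = p := by simp

/-- A nontrivial linear form in independent variables hits a given value no more likely than a
single variable does. -/
lemma measure_sum_eq_le_atom {ι : Type*} [Fintype ι] {X : ι → Ω → ℝ} (h : iIndepFun X μ)
    (hm : ∀ i, Measurable (X i)) {κ : ENNReal} (hκ : ∀ i x, μ {ω | X i ω = x} ≤ κ)
    {a : ι → ℝ} (ha : a ≠ 0) (c : ℝ) : μ {ω | ∑ i, a i * X i ω = c} ≤ κ := by
  classical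
  obtain ⟨i₀, hi₀⟩ := Function.ne_iff.mp ha
  have hind := iIndepFun.indepFun_tuple h hm (fun j : {i // i ≠ i₀} => (j : ι))
    (fun _ : Unit => i₀) (fun j _ => j.2)
  have hs : ∀ ω, ∑ i, a i * X i ω =
      ∑ j : {i // i ≠ i₀}, a j * X j ω + a i₀ * X i₀ ω := by
    intro ω
    rw [Fintype.sum_eq_add_sum_subtype_ne _ i₀, add_comm]
  simp_rw [hs]
  refine measure_indepFun_le hind (by fun_prop) (by fun_prop)
    (A := {p | ∑ j : {i // i ≠ i₀}, a j * p.1 j + a i₀ * p.2 () = c})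
    (measurableSet_eq_fun (by fun_prop) measurable_const) fun u => ?_
  refine le_trans (measure_mono ?_) (hκ i₀ ((c - ∑ j : {i // i ≠ i₀}, a j * u j) / a i₀))
  intro ω hω
  simp only [Set.mem_ofPred_eq] at hω ⊢
  rw [eq_div_iff hi₀]
  linarith

theorem exists_measure_sum_eq_le {κ : ℝ} (hκ0 : 0 ≤ κ) (hκ1 : κ < 1) :
    ∃ C : ℝ, 0 < C ∧ ∀ {Ω : Type*} [MeasurableSpace Ω] {μ : Measure Ω}
      [IsProbabilityMeasure μ] {ι : Type} [Fintype ι] (X : ι → Ω → ℝ), iIndepFun X μ →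
      (∀ i, Measurable (X i)) → (∀ i x, μ {ω | X i ω = x} ≤ ENNReal.ofReal κ) →
      ∀ (a : ι → ℝ) (c : ℝ) (k : ℕ), 1 ≤ k → k ≤ (Finset.univ.filter fun i => a i ≠ 0).card →
        μ {ω | ∑ i, a i * X i ω = c} ≤ ENNReal.ofReal (C / √k) := by
  obtain ⟨C, hC, h⟩ := exists_pi_sum_eq_le hκ0 hκ1
  refine ⟨C, hC, ?_⟩
  intro Ω _ μ _ ι _ X hX hm hκ a c k hk1 hk
  have : ∀ i, IsProbabilityMeasure (μ.map (X i)) :=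
    fun i => Measure.isProbabilityMeasure_map (hm i).aemeasurable
  have h1 := h (fun i => μ.map (X i)) (fun i x => by
    rw [Measure.map_apply (hm i) (measurableSet_singleton x)]
    exact hκ i x) a c k hk1 hk
  rw [← hX.map_fun_eq_pi_map (fun i => (hm i).aemeasurable), Measure.map_apply
    (by fun_prop) (measurableSet_eq_fun (by fun_prop) measurable_const)] at h1
  exact h1

end Independence

/-! ### Measurability of existential conditions -/

section Measurability

variable {X : Type*} [TopologicalSpace X] [MeasurableSpace X] [OpensMeasurableSpace X]

/-- The projection of a closed set along a σ-compact factor is an `F_σ`. -/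
lemma measurableSet_exists {Y : Type*} [TopologicalSpace Y] [SigmaCompactSpace Y]
    {F : Set (X × Y)} (hF : IsClosed F) : MeasurableSet {x | ∃ y, (x, y) ∈ F} := by
  have h : {x | ∃ y, (x, y) ∈ F} = ⋃ n, {x | ∃ y : compactCovering Y n, (x, (y : Y)) ∈ F} := by
    ext x
    simp only [Set.mem_ofPred_eq, Set.mem_iUnion]
    constructor
    · rintro ⟨y, hy⟩
      obtain ⟨n, hn⟩ := exists_mem_compactCovering y
      exact ⟨n, ⟨y, hn⟩, hy⟩
    · rintro ⟨n, y, hy⟩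
      exact ⟨y, hy⟩
  rw [h]
  refine MeasurableSet.iUnion fun n => IsClosed.measurableSet ?_
  have : CompactSpace (compactCovering Y n) :=
    isCompact_iff_compactSpace.mp (isCompact_compactCovering Y n)
  have hc : IsClosed {p : X × compactCovering Y n | (p.1, (p.2 : Y)) ∈ F} :=
    hF.preimage (by fun_prop)
  convert isClosedMap_fst_of_compactSpace _ hc using 1
  ext x
  simp

/-- Homogeneous closed conditions on a nonzero vector are measurable in the parameter: the vector
may be normalised to have a coordinate equal to `1`. -/
lemma measurableSet_exists_ne_zero {S : Type*} [Fintype S] {F : Set (X × (S → ℝ))}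
    (hF : IsClosed F) (hs : ∀ x v (c : ℝ), (x, v) ∈ F → (x, c • v) ∈ F) :
    MeasurableSet {x | ∃ v : S → ℝ, v ≠ 0 ∧ (x, v) ∈ F} := by
  have h : {x | ∃ v : S → ℝ, v ≠ 0 ∧ (x, v) ∈ F} =
      ⋃ s, {x | ∃ v : S → ℝ, (x, v) ∈ F ∩ {p | p.2 s = 1}} := by
    ext x
    simp only [Set.mem_ofPred_eq, Set.mem_iUnion]
    constructor
    · rintro ⟨v, hv, hF⟩
      obtain ⟨s, hs'⟩ := Function.ne_iff.mp hv
      exact ⟨s, (v s)⁻¹ • v, hs _ _ _ hF, by simpa using inv_mul_cancel₀ hs'⟩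
    · rintro ⟨s, v, hF, hv⟩
      refine ⟨v, ?_, hF⟩
      rintro rfl
      simp at hv
  rw [h]
  refine MeasurableSet.iUnion fun s => measurableSet_exists (hF.inter ?_)
  exact isClosed_eq (by fun_prop) continuous_const

end Measurability

/-! ### Tall random matrices have full column rank -/

section Tall

variable {Ω : Type*} [MeasurableSpace Ω] {μ : Measure Ω} [IsProbabilityMeasure μ]

lemma measurableSet_exists_mem_ker {S : Type*} [Fintype S] {m : ℕ} (V : Submodule ℝ (S → ℝ)) :
    MeasurableSet {x : Fin m → S → ℝ | ∃ v : S → ℝ, v ≠ 0 ∧ v ∈ V ∧ ∀ r, ∑ s, x r s * v s = 0} := by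
  refine measurableSet_exists_ne_zero
    (F := {p : (Fin m → S → ℝ) × (S → ℝ) | p.2 ∈ V ∧ ∀ r, ∑ s, p.1 r s * p.2 s = 0}) ?_ ?_
  · have h : IsClosed (⋂ r, {p : (Fin m → S → ℝ) × (S → ℝ) | ∑ s, p.1 r s * p.2 s = 0}) :=
      isClosed_iInter fun r => isClosed_eq (by fun_prop) continuous_const
    convert (V.closed_of_finiteDimensional.preimage continuous_snd).inter h using 1
    ext p
    simp
  · rintro x v c ⟨h1, h2⟩
    refine ⟨V.smul_mem c h1, fun r => ?_⟩
    have := h2 r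
    simp only [Pi.smul_apply, smul_eq_mul]
    calc ∑ s, x r s * (c * v s) = c * ∑ s, x r s * v s := by
          rw [Finset.mul_sum]; exact Finset.sum_congr rfl fun _ _ => by ring
      _ = 0 := by rw [this, mul_zero]

/-- A subspace `V` of dimension `d` meets the kernel of `m` independent random rows nontrivially
with probability at most `2 ^ d * ((1 + κ) / 2) ^ m`. Revealing one row lowers the dimension of what
is left of `V` with probability at least `1 - κ`. -/
lemma measure_exists_mem_ker_le {κ : ℝ} (hκ0 : 0 ≤ κ) {S : Type*} [Fintype S] (m : ℕ) :
    ∀ (X : Fin m → S → Ω → ℝ), iIndepFun (fun p : Fin m × S => X p.1 p.2) μ →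
    (∀ r s, Measurable (X r s)) → (∀ r s x, μ {ω | X r s ω = x} ≤ ENNReal.ofReal κ) →
    ∀ V : Submodule ℝ (S → ℝ),
      μ {ω | ∃ v : S → ℝ, v ≠ 0 ∧ v ∈ V ∧ ∀ r, ∑ s, X r s ω * v s = 0} ≤
        ENNReal.ofReal (2 ^ Module.finrank ℝ V * ((1 + κ) / 2) ^ m) := by
  induction m with
  | zero =>
    intro X _ _ _ V
    refine prob_le_one.trans ?_
    rw [ENNReal.one_le_ofReal]
    simpa using one_le_pow₀ (one_le_two (α := ℝ))
  | succ m ih =>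
    intro X hX hm hκ V
    by_cases hV : V = ⊥
    · subst hV
      have : {ω | ∃ v : S → ℝ, v ≠ 0 ∧ v ∈ (⊥ : Submodule ℝ (S → ℝ)) ∧
          ∀ r, ∑ s, X r s ω * v s = 0} = ∅ := by
        ext ω
        simp only [Submodule.mem_bot, Set.mem_ofPred_eq, Set.mem_empty_iff_false, iff_false]
        rintro ⟨v, h1, h2, _⟩
        exact h1 h2
      rw [this]; simp
    obtain ⟨v₀, hv₀, hv₀0⟩ := V.exists_mem_ne_zero_of_ne_bot hV
    set d := Module.finrank ℝ V with hd
    have hd1 : 1 ≤ d := Submodule.one_le_finrank_iff.mpr hV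
    set Y : Ω → Fin m → S → ℝ := fun ω r s => X r.succ s ω with hY
    set U : Ω → S → ℝ := fun ω s => X 0 s ω with hU
    have hUm : Measurable U := by fun_prop
    have hYm : Measurable Y := by
      refine measurable_pi_lambda _ fun r => measurable_pi_lambda _ fun s => hm _ _
    have hind : IndepFun U Y μ := by
      have h1 := iIndepFun.indepFun_tuple hX (fun p => hm _ _) (fun s : S => ((0 : Fin (m + 1)), s))
        (fun p : Fin m × S => (p.1.succ, p.2))
        (fun s p h => Fin.succ_ne_zero p.1 (congrArg Prod.fst h).symm)
      exact h1.comp (φ := id) (ψ := fun y r s => y (r, s)) measurable_id (by fun_prop)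
    have hX' : iIndepFun (fun p : Fin m × S => X p.1.succ p.2) μ :=
      hX.precomp (g := fun p : Fin m × S => (p.1.succ, p.2)) (by
        intro p q h
        simp only [Prod.mk.injEq, Fin.succ_inj] at h
        exact Prod.ext h.1 h.2)
    have ihV := ih (fun r => X r.succ) hX' (fun r s => hm _ _) (fun r s x => hκ _ _ _)
    let A : Set ((S → ℝ) × (Fin m → S → ℝ)) := {p | ∃ v : S → ℝ, v ≠ 0 ∧ v ∈ V ∧
      ∑ s, p.1 s * v s = 0 ∧ ∀ r, ∑ s, p.2 r s * v s = 0}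
    have hA : MeasurableSet A := by
      have h1 : Measurable fun p : (S → ℝ) × (Fin m → S → ℝ) =>
          (Fin.cons p.1 p.2 : Fin (m + 1) → S → ℝ) := by
        refine measurable_pi_lambda _ fun r => ?_
        refine Fin.cases ?_ (fun r => ?_) r
        · simpa using measurable_fst
        · exact (measurable_pi_apply r).comp measurable_snd
      have h2 := h1 (measurableSet_exists_mem_ker (m := m + 1) V)
      convert h2 using 1
      ext p
      simp [A, Fin.forall_fin_succ]
    have hsplit : {ω | ∃ v : S → ℝ, v ≠ 0 ∧ v ∈ V ∧ ∀ r, ∑ s, X r s ω * v s = 0} =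
        {ω | (U ω, Y ω) ∈ A} := by
      ext ω
      simp [A, Fin.forall_fin_succ, hU, hY]
    rw [hsplit, measure_indepFun hind hUm hYm hA]
    set b : ℝ := 2 ^ (d - 1) * ((1 + κ) / 2) ^ m with hb
    have hb0 : 0 ≤ b := by positivity
    have h2b : 2 ^ d * ((1 + κ) / 2) ^ m = b + b := by
      rw [hb, ← two_mul, ← mul_assoc, ← pow_succ', Nat.sub_add_cancel hd1]
    let E : Set Ω := {ω | ∑ s, v₀ s * X 0 s ω = 0}
    have hE : MeasurableSet E := measurableSet_eq_fun (by fun_prop) measurable_const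
    have hEκ : μ E ≤ ENNReal.ofReal κ := by
      refine measure_sum_eq_le_atom (X := fun s => X 0 s) ?_ (fun s => hm _ _)
        (fun s x => hκ _ _ _) hv₀0 0
      exact hX.precomp (g := fun s => ((0 : Fin (m + 1)), s)) (fun s t h => by simpa using h)
    have hpt : ∀ ω, μ {ω' | (U ω, Y ω') ∈ A} ≤
        ENNReal.ofReal b + ENNReal.ofReal b * E.indicator 1 ω := by
      intro ω
      by_cases hω : ω ∈ E
      · rw [Set.indicator_of_mem hω, Pi.one_apply, mul_one, ← ENNReal.ofReal_add hb0 hb0, ← h2b]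
        refine le_trans (measure_mono ?_) (ihV V)
        rintro ω' ⟨v, h1, h2, _, h3⟩
        exact ⟨v, h1, h2, h3⟩
      · rw [Set.indicator_of_notMem hω, mul_zero, add_zero]
        let ℓ : (S → ℝ) →ₗ[ℝ] ℝ := ∑ s, (U ω s) • LinearMap.proj s
        have hℓ : ∀ v, ℓ v = ∑ s, U ω s * v s := by
          intro v; simp [ℓ, LinearMap.sum_apply]
        have hlt : Module.finrank ℝ (V ⊓ LinearMap.ker ℓ : Submodule ℝ (S → ℝ)) < d := by
          apply Submodule.finrank_lt_finrank_of_lt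
          refine lt_of_le_of_ne inf_le_left fun h => hω ?_
          have : v₀ ∈ V ⊓ LinearMap.ker ℓ := by rw [h]; exact hv₀
          have h3 : ℓ v₀ = 0 := this.2
          rw [hℓ] at h3
          change ∑ s, v₀ s * X 0 s ω = 0
          rw [← h3]
          exact Finset.sum_congr rfl fun s _ => mul_comm _ _
        refine le_trans (measure_mono ?_) ((ihV (V ⊓ LinearMap.ker ℓ)).trans
          (ENNReal.ofReal_le_ofReal ?_))
        · rintro ω' ⟨v, h1, h2, h3, h4⟩
          exact ⟨v, h1, ⟨h2, LinearMap.mem_ker.mpr ((hℓ v).trans h3)⟩, h4⟩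
        · rw [hb]
          gcongr
          · norm_num
          · omega
    calc _ ≤ ∫⁻ ω, (ENNReal.ofReal b + ENNReal.ofReal b * E.indicator 1 ω) ∂μ :=
          lintegral_mono hpt
      _ = ENNReal.ofReal b + ENNReal.ofReal b * μ E := by
          rw [lintegral_add_left measurable_const,
            lintegral_const_mul _ (measurable_one.indicator hE), lintegral_indicator_one hE]
          simp
      _ ≤ ENNReal.ofReal b + ENNReal.ofReal b * ENNReal.ofReal κ := by gcongr
      _ = ENNReal.ofReal (2 ^ d * ((1 + κ) / 2) ^ (m + 1)) := by
          rw [← ENNReal.ofReal_mul hb0, ← ENNReal.ofReal_add hb0 (by positivity)]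
          congr 1
          rw [pow_succ, ← mul_assoc, h2b]; ring

lemma measure_exists_ker_le {κ : ℝ} (hκ0 : 0 ≤ κ) {R S : Type*} [Fintype R] [Fintype S]
    {X : R → S → Ω → ℝ} (hX : iIndepFun (fun p : R × S => X p.1 p.2) μ)
    (hm : ∀ r s, Measurable (X r s)) (hκ : ∀ r s x, μ {ω | X r s ω = x} ≤ ENNReal.ofReal κ) :
    μ {ω | ∃ v : S → ℝ, v ≠ 0 ∧ ∀ r, ∑ s, X r s ω * v s = 0} ≤
      ENNReal.ofReal (2 ^ Fintype.card S * ((1 + κ) / 2) ^ Fintype.card R) := by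
  let e := Fintype.equivFin R
  have h := measure_exists_mem_ker_le (μ := μ) hκ0 (Fintype.card R) (fun r => X (e.symm r))
    (hX.precomp (g := fun p : Fin (Fintype.card R) × S => (e.symm p.1, p.2)) (by
      intro p q h
      simp only [Prod.mk.injEq, EmbeddingLike.apply_eq_iff_eq] at h
      exact Prod.ext h.1 h.2)) (fun r s => hm _ _) (fun r s x => hκ _ _ _) ⊤
  rw [finrank_top, Module.finrank_fintype_fun_eq_card] at h
  refine le_trans (measure_mono ?_) h
  rintro ω ⟨v, h1, h2⟩
  exact ⟨v, h1, Submodule.mem_top, fun r => h2 _⟩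

end Tall

/-! ### Union bounds over sparse vectors -/

/-- Below a small density `1 / L`, the number of supports of sparse vectors is outweighed by the
exponentially small probability attached to each of them. -/
lemma exists_choose_mul_pow_le {θ : ℝ} (h0 : 0 < θ) (h1 : θ < 1) :
    ∃ (L : ℕ) (q K : ℝ), 1 ≤ L ∧ 0 < q ∧ q < 1 ∧ 0 < K ∧ ∀ n : ℕ,
      n * ((n.choose (n / L) : ℝ) * (2 ^ (n / L) * θ ^ (n - (n / L + 1)))) ≤ K * q ^ n := by
  -- `u ^ 4 = θ` leaves room for three factors `u ^ n`: one for the binomial coefficient, one for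
  -- the powers with exponent `n / L`, and one for the factor `n`
  set u : ℝ := √√θ with hu
  have hu0 : 0 < u := Real.sqrt_pos.mpr (Real.sqrt_pos.mpr h0)
  have hu4 : u ^ 4 = θ := by
    rw [show u ^ 4 = (u ^ 2) ^ 2 by ring, Real.sq_sqrt (Real.sqrt_nonneg _), Real.sq_sqrt h0.le]
  have hu1 : u < 1 := by
    by_contra h
    have := one_le_pow₀ (not_lt.mp h) (n := 4)
    linarith
  set t : ℝ := u⁻¹ - 1 with ht
  have ht0 : 0 < t := by
    have := (one_lt_inv₀ hu0).mpr hu1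
    linarith
  set A : ℝ := 2 / (t * θ) with hA
  have hA0 : 0 < A := by positivity
  obtain ⟨L, hL⟩ := exists_pow_lt_of_lt_one (show 0 < A⁻¹ by positivity) hu1
  obtain ⟨K, hK0, hK⟩ := exists_mul_pow_le hu0.le hu1
  refine ⟨L + 1, u, K / θ, by omega, hu0, hu1, by positivity, fun n => ?_⟩
  set k := n / (L + 1) with hk
  have hkn : (L + 1) * k ≤ n := Nat.mul_div_le n (L + 1)
  have hA' : A * u ^ (L + 1) ≤ 1 := by
    have : u ^ (L + 1) ≤ A⁻¹ := (pow_le_pow_of_le_one hu0.le hu1.le (by omega)).trans hL.le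
    calc A * u ^ (L + 1) ≤ A * A⁻¹ := by gcongr
      _ = 1 := mul_inv_cancel₀ hA0.ne'
  have hAk : A ^ k * u ^ n ≤ 1 := by
    calc A ^ k * u ^ n ≤ A ^ k * u ^ ((L + 1) * k) := by
          gcongr A ^ k * ?_
          exact pow_le_pow_of_le_one hu0.le hu1.le hkn
      _ = (A * u ^ (L + 1)) ^ k := by rw [mul_pow, pow_mul]
      _ ≤ 1 := pow_le_one₀ (by positivity) hA'
  have hkn' : k ≤ n := le_trans (by nlinarith) hkn
  have hch : (n.choose k : ℝ) * t ^ k ≤ (u⁻¹) ^ n := by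
    have h := add_pow t 1 n
    rw [show t + 1 = u⁻¹ by rw [ht]; ring] at h
    rw [h]
    have := Finset.single_le_sum (f := fun m => t ^ m * 1 ^ (n - m) * (n.choose m : ℝ))
      (fun i _ => by positivity) (Finset.mem_range.mpr (Nat.lt_succ_of_le hkn'))
    simp only [one_pow, mul_one] at this ⊢
    linarith
  have hθ : θ ^ (n - (k + 1)) * θ ^ (k + 1) ≤ θ ^ n := by
    rw [← pow_add]
    exact pow_le_pow_of_le_one h0.le h1.le (by omega)
  have main : (n.choose k : ℝ) * (2 ^ k * θ ^ (n - (k + 1))) * θ ≤ u ^ n * u ^ n := by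
    have h2 : (n.choose k : ℝ) * (2 ^ k * θ ^ (n - (k + 1))) * θ =
        ((n.choose k : ℝ) * t ^ k) * A ^ k * (θ ^ (n - (k + 1)) * θ ^ (k + 1)) := by
      have : t ^ k * A ^ k * θ ^ k = 2 ^ k := by
        rw [← mul_pow, ← mul_pow]
        congr 1
        rw [hA]; field_simp
      rw [← this, pow_succ]; ring
    rw [h2]
    calc _ ≤ (u⁻¹) ^ n * A ^ k * θ ^ n := by gcongr
      _ = (u⁻¹ ^ n * u ^ n) * (A ^ k * u ^ n) * (u ^ n * u ^ n) := by
        rw [← hu4]; ring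
      _ ≤ 1 * 1 * (u ^ n * u ^ n) := by
        have : u⁻¹ ^ n * u ^ n = 1 := by rw [← mul_pow, inv_mul_cancel₀ hu0.ne', one_pow]
        rw [this]
        gcongr
      _ = _ := by ring
  rw [div_mul_eq_mul_div, le_div_iff₀ h0]
  calc _ = n * ((n.choose k : ℝ) * (2 ^ k * θ ^ (n - (k + 1))) * θ) := by ring
    _ ≤ n * (u ^ n * u ^ n) := by gcongr
    _ = (n * u ^ n) * u ^ n := by ring
    _ ≤ K * u ^ n := by gcongr; exact hK n

/-- The number of nonzero coordinates of a vector. -/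
noncomputable def supportCard {ι : Type*} [Fintype ι] (v : ι → ℝ) : ℕ :=
  (Finset.univ.filter fun i => v i ≠ 0).card

lemma exists_superset_of_supportCard_le {ι : Type*} [Fintype ι] {v : ι → ℝ} {k : ℕ}
    (hk : k ≤ Fintype.card ι) (hv : supportCard v ≤ k) :
    ∃ T : Finset ι, T.card = k ∧ ∀ i ∉ T, v i = 0 := by
  obtain ⟨T, hT, _, hc⟩ := Finset.exists_subsuperset_card_eq
    (Finset.subset_univ (Finset.univ.filter fun i => v i ≠ 0)) hv (by simpa using hk)
  refine ⟨T, hc, fun i hi => ?_⟩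
  by_contra h
  exact hi (hT (by simp [h]))

lemma isClosed_supportCard_le {ι : Type*} [Fintype ι] {k : ℕ} (hk : k ≤ Fintype.card ι) :
    IsClosed {v : ι → ℝ | supportCard v ≤ k} := by
  have : {v : ι → ℝ | supportCard v ≤ k} =
      ⋃ T ∈ {T : Finset ι | T.card = k}, ⋂ i ∈ {i | i ∉ T}, {v | v i = 0} := by
    ext v
    simp only [Set.mem_ofPred_eq, Set.mem_iUnion, Set.mem_iInter, exists_prop]
    constructor
    · exact exists_superset_of_supportCard_le hk
    · rintro ⟨T, hT, h⟩
      rw [← hT]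
      refine Finset.card_le_card fun i hi => ?_
      by_contra hc
      exact (Finset.mem_filter.mp hi).2 (h i hc)
  rw [this]
  refine Set.Finite.isClosed_biUnion (Set.toFinite _) fun T _ => ?_
  exact isClosed_biInter fun i _ => isClosed_eq (continuous_apply i) continuous_const

lemma supportCard_smul_le {ι : Type*} [Fintype ι] (c : ℝ) (v : ι → ℝ) :
    supportCard (c • v) ≤ supportCard v := by
  refine Finset.card_le_card fun i hi => ?_
  simp only [Finset.mem_filter, Finset.mem_univ, true_and, Pi.smul_apply, smul_eq_mul, ne_eq,
    mul_eq_zero, not_or] at hi ⊢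
  exact hi.2

section

variable {Ω : Type*} [MeasurableSpace Ω] {μ : Measure Ω}

lemma measure_exists_sparse_le {ι : Type*} [Fintype ι] {k : ℕ} (hk : k ≤ Fintype.card ι)
    (P : Ω → (ι → ℝ) → Prop) {b : ENNReal}
    (h : ∀ T : Finset ι, T.card = k →
      μ {ω | ∃ v : ι → ℝ, v ≠ 0 ∧ (∀ i ∉ T, v i = 0) ∧ P ω v} ≤ b) :
    μ {ω | ∃ v : ι → ℝ, v ≠ 0 ∧ supportCard v ≤ k ∧ P ω v} ≤
      ((Fintype.card ι).choose k : ENNReal) * b := by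
  have hsub : {ω | ∃ v : ι → ℝ, v ≠ 0 ∧ supportCard v ≤ k ∧ P ω v} ⊆
      ⋃ T ∈ Finset.powersetCard k (Finset.univ : Finset ι),
        {ω | ∃ v : ι → ℝ, v ≠ 0 ∧ (∀ i ∉ T, v i = 0) ∧ P ω v} := by
    rintro ω ⟨v, h1, h2, h3⟩
    obtain ⟨T, hT, hv⟩ := exists_superset_of_supportCard_le hk h2
    simp only [Set.mem_iUnion, Finset.mem_powersetCard, Finset.subset_univ, true_and]
    exact ⟨T, hT, v, h1, hv, h3⟩
  calc _ ≤ _ := measure_mono hsub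
    _ ≤ ∑ T ∈ Finset.powersetCard k (Finset.univ : Finset ι),
        μ {ω | ∃ v : ι → ℝ, v ≠ 0 ∧ (∀ i ∉ T, v i = 0) ∧ P ω v} := measure_biUnion_finset_le _ _
    _ ≤ ∑ T ∈ Finset.powersetCard k (Finset.univ : Finset ι), b :=
        Finset.sum_le_sum fun T hT => h T (Finset.mem_powersetCard.mp hT).2
    _ = _ := by simp

lemma restrict_ne_zero {ι : Type*} {T : Finset ι} {v : ι → ℝ} (h1 : v ≠ 0)
    (h2 : ∀ i ∉ T, v i = 0) : (fun s : T => v s) ≠ 0 := by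
  intro h
  apply h1
  ext i
  by_cases hi : i ∈ T
  · exact congrFun h ⟨i, hi⟩
  · exact h2 i hi

lemma sum_mul_eq_sum_restrict {ι : Type*} [Fintype ι] {T : Finset ι} {v : ι → ℝ}
    (h2 : ∀ i ∉ T, v i = 0) (x : ι → ℝ) : ∑ i, x i * v i = ∑ s : T, x s * v s := by
  rw [Finset.sum_coe_sort T (fun i => x i * v i)]
  refine (Finset.sum_subset (Finset.subset_univ T) fun i _ hi => ?_).symm
  rw [h2 i hi, mul_zero]

lemma measure_exists_sparse_ker_le [IsProbabilityMeasure μ] {κ : ℝ} (hκ0 : 0 ≤ κ)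
    {R ι : Type*} [Fintype R] [Fintype ι]
    {X : R → ι → Ω → ℝ} (hX : iIndepFun (fun p : R × ι => X p.1 p.2) μ)
    (hm : ∀ r i, Measurable (X r i)) (hκ : ∀ r i x, μ {ω | X r i ω = x} ≤ ENNReal.ofReal κ)
    {k : ℕ} (hk : k ≤ Fintype.card ι) :
    μ {ω | ∃ v : ι → ℝ, v ≠ 0 ∧ supportCard v ≤ k ∧ ∀ r, ∑ i, X r i ω * v i = 0} ≤
      ENNReal.ofReal ((Fintype.card ι).choose k * (2 ^ k * ((1 + κ) / 2) ^ Fintype.card R)) := by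
  rw [ENNReal.ofReal_mul (by positivity), ENNReal.ofReal_natCast]
  refine measure_exists_sparse_le hk _ fun T hT => ?_
  have h := measure_exists_ker_le (μ := μ) hκ0 (R := R) (S := T) (X := fun r s => X r s)
    (hX.precomp (g := fun p : R × T => (p.1, (p.2 : ι))) (by
      intro p q h
      simp only [Prod.mk.injEq] at h
      exact Prod.ext h.1 (Subtype.ext h.2))) (fun r s => hm _ _) (fun r s x => hκ _ _ _)
  rw [Fintype.card_coe, hT] at h
  refine le_trans (measure_mono ?_) h
  rintro ω ⟨v, h1, h2, h3⟩
  refine ⟨fun s => v s, restrict_ne_zero h1 h2, fun r => ?_⟩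
  rw [← h3 r]
  exact (sum_mul_eq_sum_restrict h2 fun i => X r i ω).symm

/-- Markov's inequality for the number of occurring events. -/
lemma mul_measure_le_sum {ι : Type*} [Fintype ι] {E : ι → Set Ω} (hE : ∀ i, MeasurableSet (E i))
    {K : ℕ} {B : Set Ω} (hB : ∀ ω ∈ B, ∃ T : Finset ι, K ≤ T.card ∧ ∀ i ∈ T, ω ∈ E i) :
    (K : ENNReal) * μ B ≤ ∑ i, μ (E i) := by
  have h1 : ∑ i, μ (E i) = ∫⁻ ω, ∑ i, (E i).indicator 1 ω ∂μ := by
    rw [lintegral_finsetSum _ fun i _ => measurable_one.indicator (hE i)]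
    exact Finset.sum_congr rfl fun i _ => (lintegral_indicator_one (hE i)).symm
  rw [h1]
  refine le_trans ?_ (mul_meas_ge_le_lintegral
    (Finset.measurable_sum _ fun i _ => measurable_one.indicator (hE i)) (K : ENNReal))
  gcongr
  intro ω hω
  obtain ⟨T, hT, h⟩ := hB ω hω
  calc (K : ENNReal) ≤ T.card := by exact_mod_cast hT
    _ = ∑ i ∈ T, (E i).indicator (1 : Ω → ENNReal) ω := by
      rw [Finset.sum_congr rfl fun i hi => Set.indicator_of_mem (h i hi) _]
      simp
    _ ≤ _ := Finset.sum_le_sum_of_subset (Finset.subset_univ T)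

end

/-! ### Matrices with independent entries -/

section Ginibre

lemma exists_ne_zero_forall_sum_eq_zero {n : ℕ} (i : Fin n) (u : {r : Fin n // r ≠ i} → Fin n → ℝ) :
    ∃ w : Fin n → ℝ, w ≠ 0 ∧ ∀ r, ∑ j, u r j * w j = 0 := by
  have hlt : Module.finrank ℝ ({r : Fin n // r ≠ i} → ℝ) < Module.finrank ℝ (Fin n → ℝ) := by
    simp only [Module.finrank_fintype_fun_eq_card]
    exact Fintype.card_subtype_lt (x := i) (by simp)
  have h := LinearMap.ker_ne_bot_of_finrank_lt (f := Matrix.mulVecLin (Matrix.of u)) hlt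
  obtain ⟨w, hw, hw0⟩ := Submodule.exists_mem_ne_zero_of_ne_bot h
  exact ⟨w, hw0, fun r => congrFun hw r⟩

variable {Ω : Type*} [MeasurableSpace Ω] {μ : Measure Ω} [IsProbabilityMeasure μ]

lemma measurableSet_exists_sparse_ker {R ι : Type*} [Fintype R] [Fintype ι] {k : ℕ}
    (hk : k ≤ Fintype.card ι) :
    MeasurableSet {x : R → ι → ℝ | ∃ v : ι → ℝ, v ≠ 0 ∧ supportCard v ≤ k ∧
      ∀ r, ∑ i, x r i * v i = 0} := by
  refine measurableSet_exists_ne_zero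
    (F := {p : (R → ι → ℝ) × (ι → ℝ) | supportCard p.2 ≤ k ∧ ∀ r, ∑ s, p.1 r s * p.2 s = 0}) ?_ ?_
  · have h : IsClosed (⋂ r, {p : (R → ι → ℝ) × (ι → ℝ) | ∑ s, p.1 r s * p.2 s = 0}) :=
      isClosed_iInter fun r => isClosed_eq (by fun_prop) continuous_const
    convert ((isClosed_supportCard_le hk).preimage continuous_snd).inter h using 1
    ext p
    simp
  · rintro x v c ⟨h1, h2⟩
    refine ⟨(supportCard_smul_le c v).trans h1, fun r => ?_⟩
    simp only [Pi.smul_apply, smul_eq_mul]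
    calc ∑ s, x r s * (c * v s) = c * ∑ s, x r s * v s := by
          rw [Finset.mul_sum]; exact Finset.sum_congr rfl fun _ _ => by ring
      _ = 0 := by rw [h2 r, mul_zero]

/-- The set of matrices, split into row `i` and the other rows, whose row `i` is in the span of the
others. -/
def rowMemSpan {n : ℕ} (i : Fin n) :
    Set (({r : Fin n // r ≠ i} → Fin n → ℝ) × (Fin n → ℝ)) :=
  {p | ∃ c : {r : Fin n // r ≠ i} → ℝ, ∀ j, p.2 j + ∑ r, c r * p.1 r j = 0}

lemma measurableSet_rowMemSpan {n : ℕ} (i : Fin n) : MeasurableSet (rowMemSpan i) := by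
  refine measurableSet_exists (F := {q : (({r : Fin n // r ≠ i} → Fin n → ℝ) × (Fin n → ℝ)) ×
    ({r : Fin n // r ≠ i} → ℝ) | ∀ j, q.1.2 j + ∑ r, q.2 r * q.1.1 r j = 0}) ?_
  have h : IsClosed (⋂ j, {q : (({r : Fin n // r ≠ i} → Fin n → ℝ) × (Fin n → ℝ)) ×
      ({r : Fin n // r ≠ i} → ℝ) | q.1.2 j + ∑ r, q.2 r * q.1.1 r j = 0}) :=
    isClosed_iInter fun j => isClosed_eq (by fun_prop) continuous_const
  convert h using 1
  ext p
  simp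

/-- A row lies in the span of the others with probability `O(k ^ (-1/2))`, unless the other rows
are orthogonal to a sparse vector: the row has to be orthogonal to some vector with more than
`k` nonzero coordinates that is determined by the other rows. -/
lemma measure_rowMemSpan_le {n k : ℕ} (hkn : k ≤ n) {X : Fin n → Fin n → Ω → ℝ}
    (hX : iIndepFun (fun p : Fin n × Fin n => X p.1 p.2) μ)
    (hm : ∀ i j, Measurable (X i j)) {p : ENNReal} (i : Fin n)
    (hp : ∀ w : Fin n → ℝ, k + 1 ≤ supportCard w → μ {ω | ∑ j, w j * X i j ω = 0} ≤ p) :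
    μ {ω | ((fun (r : {r : Fin n // r ≠ i}) j => X r j ω), fun j => X i j ω) ∈ rowMemSpan i} ≤
      μ {ω | ∃ v : Fin n → ℝ, v ≠ 0 ∧ supportCard v ≤ k ∧
        ∀ r : {r : Fin n // r ≠ i}, ∑ j, X r j ω * v j = 0} + p := by
  set U : Ω → {r : Fin n // r ≠ i} → Fin n → ℝ := fun ω r j => X r j ω
  set Y : Ω → Fin n → ℝ := fun ω j => X i j ω
  have hU : Measurable U :=
    measurable_pi_lambda _ fun r => measurable_pi_lambda _ fun j => hm _ _
  have hY : Measurable Y := measurable_pi_lambda _ fun j => hm _ _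
  have hind : IndepFun U Y μ := by
    have h1 := iIndepFun.indepFun_tuple hX (fun p => hm _ _)
      (fun p : {r : Fin n // r ≠ i} × Fin n => ((p.1 : Fin n), p.2)) (fun j : Fin n => (i, j))
      (fun p j h => p.1.2 (congrArg Prod.fst h))
    exact h1.comp (φ := fun y r j => y (r, j)) (ψ := id) (by fun_prop) measurable_id
  set B : Set ({r : Fin n // r ≠ i} → Fin n → ℝ) := {x | ∃ v : Fin n → ℝ, v ≠ 0 ∧
    supportCard v ≤ k ∧ ∀ r, ∑ j, x r j * v j = 0} with hB
  have hBm : MeasurableSet B := measurableSet_exists_sparse_ker (by simpa using hkn)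
  have hsub : {ω | (U ω, Y ω) ∈ rowMemSpan i} ⊆
      {ω | U ω ∈ B} ∪ {ω | (U ω, Y ω) ∈ rowMemSpan i ∩ Prod.fst ⁻¹' Bᶜ} := by
    intro ω hω
    by_cases h : U ω ∈ B
    · exact Or.inl h
    · exact Or.inr ⟨hω, h⟩
  refine (measure_mono hsub).trans ((measure_union_le _ _).trans (add_le_add le_rfl ?_))
  refine measure_indepFun_le hind hU hY
    ((measurableSet_rowMemSpan i).inter (measurable_fst hBm.compl)) fun u => ?_
  by_cases hu : u ∈ B
  · have : {ω' | (u, Y ω') ∈ rowMemSpan i ∩ Prod.fst ⁻¹' Bᶜ} = ∅ := by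
      ext ω; simp [hu]
    rw [this]; simp
  · obtain ⟨w, hw0, hw⟩ := exists_ne_zero_forall_sum_eq_zero i u
    have hwk : k + 1 ≤ supportCard w := by
      by_contra h
      exact hu ⟨w, hw0, by omega, hw⟩
    refine le_trans (measure_mono ?_) (hp w hwk)
    rintro ω ⟨⟨c, hc⟩, _⟩
    have h1 : ∑ j, w j * (Y ω j + ∑ r, c r * u r j) = 0 :=
      Finset.sum_eq_zero fun j _ => by rw [hc j, mul_zero]
    have h2 : ∑ j, w j * ∑ r, c r * u r j = 0 := by
      simp_rw [Finset.mul_sum]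
      rw [Finset.sum_comm]
      refine Finset.sum_eq_zero fun r _ => ?_
      calc ∑ j, w j * (c r * u r j) = c r * ∑ j, u r j * w j := by
            rw [Finset.mul_sum]; exact Finset.sum_congr rfl fun _ _ => by ring
        _ = 0 := by rw [hw r, mul_zero]
    simp_rw [mul_add] at h1
    rw [Finset.sum_add_distrib, h2, add_zero] at h1
    exact h1

/-- Komlós' argument. A dependence between the rows with more than `k` nonzero coefficients
puts more than `k` rows in the span of the others. -/
lemma measure_exists_left_ker_le {n k : ℕ} (hkn : k ≤ n) {X : Fin n → Fin n → Ω → ℝ}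
    (hX : iIndepFun (fun p : Fin n × Fin n => X p.1 p.2) μ)
    (hm : ∀ i j, Measurable (X i j)) {κ : ℝ} (hκ0 : 0 ≤ κ)
    (hκ : ∀ r s x, μ {ω | X r s ω = x} ≤ ENNReal.ofReal κ) {b p : ℝ} (hp0 : 0 ≤ p)
    (hb : n.choose k * (2 ^ k * ((1 + κ) / 2) ^ n) ≤ b)
    (hb' : n.choose k * (2 ^ k * ((1 + κ) / 2) ^ (n - 1)) ≤ b)
    (hp : ∀ i, ∀ w : Fin n → ℝ, k + 1 ≤ supportCard w →
      μ {ω | ∑ j, w j * X i j ω = 0} ≤ ENNReal.ofReal p) :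
    μ {ω | ∃ v : Fin n → ℝ, v ≠ 0 ∧ ∀ j, ∑ i, X i j ω * v i = 0} ≤
      ENNReal.ofReal (b + n * (b + p) / (k + 1)) := by
  have hb0 : 0 ≤ b := le_trans (by positivity) hb
  set E₀ : Set Ω := {ω | ∃ v : Fin n → ℝ, v ≠ 0 ∧ supportCard v ≤ k ∧
    ∀ j, ∑ i, X i j ω * v i = 0} with hE₀
  have hE₀b : μ E₀ ≤ ENNReal.ofReal b := by
    have h := measure_exists_sparse_ker_le (μ := μ) hκ0 (R := Fin n) (ι := Fin n)
      (X := fun j i => X i j) (hX.precomp (g := Prod.swap) Prod.swap_injective)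
      (fun _ _ => hm _ _) (fun _ _ _ => hκ _ _ _) (k := k) (by simpa using hkn)
    rw [Fintype.card_fin] at h
    exact h.trans (ENNReal.ofReal_le_ofReal hb)
  let E : Fin n → Set Ω := fun i =>
    {ω | ((fun (r : {r : Fin n // r ≠ i}) j => X r j ω), fun j => X i j ω) ∈ rowMemSpan i}
  have hEm : ∀ i, MeasurableSet (E i) := fun i =>
    ((measurable_pi_lambda _ fun r => measurable_pi_lambda _ fun j => hm _ _).prodMk
      (measurable_pi_lambda _ fun j => hm _ _)) (measurableSet_rowMemSpan i)
  have hE : ∀ i, μ (E i) ≤ ENNReal.ofReal (b + p) := by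
    intro i
    refine (measure_rowMemSpan_le hkn hX hm i (hp i)).trans ?_
    rw [ENNReal.ofReal_add hb0 hp0]
    gcongr
    have h := measure_exists_sparse_ker_le (μ := μ) hκ0 (R := {r : Fin n // r ≠ i}) (ι := Fin n)
      (X := fun r j => X r j)
      (hX.precomp (g := fun q : {r : Fin n // r ≠ i} × Fin n => ((q.1 : Fin n), q.2)) (by
        intro p q h
        simp only [Prod.mk.injEq] at h
        exact Prod.ext (Subtype.ext h.1) h.2))
      (fun _ _ => hm _ _) (fun _ _ _ => hκ _ _ _) (k := k) (by simpa using hkn)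
    have hc : Fintype.card {r : Fin n // r ≠ i} = n - 1 := by
      rw [Fintype.card_subtype_compl]; simp
    rw [Fintype.card_fin, hc] at h
    exact h.trans (ENNReal.ofReal_le_ofReal hb')
  set B : Set Ω := {ω | ∃ v : Fin n → ℝ, v ≠ 0 ∧ ∀ j, ∑ i, X i j ω * v i = 0} \ E₀ with hBdef
  have hB : ((k + 1 : ℕ) : ENNReal) * μ B ≤ ∑ i, μ (E i) := by
    refine mul_measure_le_sum hEm ?_
    rintro ω ⟨⟨v, hv0, hv⟩, hω⟩
    refine ⟨Finset.univ.filter fun i => v i ≠ 0, ?_, ?_⟩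
    · by_contra h
      exact hω ⟨v, hv0, by unfold supportCard; omega, hv⟩
    · intro i hi
      have hi' : v i ≠ 0 := (Finset.mem_filter.mp hi).2
      refine ⟨fun r => (v i)⁻¹ * v r, fun j => ?_⟩
      have h1 := hv j
      rw [Fintype.sum_eq_add_sum_subtype_ne _ i] at h1
      have h2 : ∑ r : {r : Fin n // r ≠ i}, (v i)⁻¹ * v r * X r j ω =
          (v i)⁻¹ * ∑ r : {r : Fin n // r ≠ i}, X r j ω * v r := by
        rw [Finset.mul_sum]; exact Finset.sum_congr rfl fun _ _ => by ring
      change X i j ω + ∑ r : {r : Fin n // r ≠ i}, (v i)⁻¹ * v r * X r j ω = 0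
      rw [h2]
      field_simp
      linarith
  have hBb : μ B ≤ ENNReal.ofReal (n * (b + p) / (k + 1)) := by
    have h1 : ((k + 1 : ℕ) : ENNReal) * μ B ≤ ENNReal.ofReal (n * (b + p)) := by
      refine hB.trans ((Finset.sum_le_sum fun i _ => hE i).trans ?_)
      rw [Finset.sum_const, Finset.card_univ, Fintype.card_fin, nsmul_eq_mul,
        ENNReal.ofReal_mul (by positivity), ENNReal.ofReal_natCast]
    rw [ENNReal.ofReal_div_of_pos (by positivity), ENNReal.le_div_iff_mul_le]
    · rw [mul_comm]
      convert h1 using 2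
      rw [← ENNReal.ofReal_natCast]; push_cast; rfl
    · left
      simp only [ne_eq, ENNReal.ofReal_eq_zero, not_le]; positivity
    · left; exact ENNReal.ofReal_ne_top
  have hsub : {ω | ∃ v : Fin n → ℝ, v ≠ 0 ∧ ∀ j, ∑ i, X i j ω * v i = 0} ⊆ E₀ ∪ B := by
    intro ω hω
    by_cases h : ω ∈ E₀
    · exact Or.inl h
    · exact Or.inr ⟨hω, h⟩
  refine (measure_mono hsub).trans ((measure_union_le _ _).trans ?_)
  rw [ENNReal.ofReal_add hb0 (by positivity)]
  gcongr

/-- A random matrix with independent entries is singular with probability `O(n ^ (-1/2))`. -/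
theorem exists_measure_exists_left_ker_le {κ : ℝ} (hκ0 : 0 ≤ κ) (hκ1 : κ < 1) :
    ∃ C : ℝ, 0 < C ∧ ∀ {Ω : Type*} [MeasurableSpace Ω] {μ : Measure Ω}
      [IsProbabilityMeasure μ] {n : ℕ} {X : Fin n → Fin n → Ω → ℝ}, 1 ≤ n →
      iIndepFun (fun p : Fin n × Fin n => X p.1 p.2) μ → (∀ i j, Measurable (X i j)) →
      (∀ i j x, μ {ω | X i j ω = x} ≤ ENNReal.ofReal κ) →
      μ {ω | ∃ v : Fin n → ℝ, v ≠ 0 ∧ ∀ j, ∑ i, X i j ω * v i = 0} ≤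
        ENNReal.ofReal (C / √n) := by
  set θ : ℝ := (1 + κ) / 2 with hθ
  have hθ0 : 0 < θ := by positivity
  have hθ1 : θ < 1 := by rw [hθ]; linarith
  obtain ⟨C, hC, hLO⟩ := exists_measure_sum_eq_le hκ0 hκ1
  obtain ⟨L, q, K, hL, hq0, hq1, hK, hcount⟩ := exists_choose_mul_pow_le hθ0 hθ1
  obtain ⟨K', hK', hqs⟩ := exists_pow_le_div_sqrt hq0.le hq1
  refine ⟨K * K' + L * (K * K' + C * √L), by positivity, ?_⟩
  intro Ω _ μ _ n X hn hX hm hκ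
  set k := n / L with hk
  have hkn : k ≤ n := Nat.div_le_self n L
  have hnR : (1 : ℝ) ≤ n := by exact_mod_cast hn
  have hLk : (n : ℝ) ≤ L * (k + 1) := by
    have := Nat.lt_mul_div_succ n (show 0 < L by omega)
    have h2 : n ≤ L * (k + 1) := this.le
    exact_mod_cast h2
  set b : ℝ := K * K' / √n with hb
  have hcb : n.choose k * (2 ^ k * θ ^ (n - (k + 1))) ≤ b := by
    calc (n.choose k : ℝ) * (2 ^ k * θ ^ (n - (k + 1)))
        ≤ n * (n.choose k * (2 ^ k * θ ^ (n - (k + 1)))) :=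
          le_mul_of_one_le_left (by positivity) hnR
      _ ≤ K * q ^ n := hcount n
      _ ≤ K * (K' / √n) := by gcongr; exact hqs n hn
      _ = b := by rw [hb]; ring
  have hmono : ∀ e, n - (k + 1) ≤ e → n.choose k * (2 ^ k * θ ^ e) ≤ b := by
    intro e he
    refine le_trans ?_ hcb
    gcongr _ * (_ * ?_)
    exact pow_le_pow_of_le_one hθ0.le hθ1.le he
  have hpk : C / √((k + 1 : ℕ) : ℝ) ≤ C * √L / √n := by
    rw [div_le_div_iff₀ (by positivity) (by positivity), mul_assoc]
    gcongr
    rw [← Real.sqrt_mul (by positivity)]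
    apply Real.sqrt_le_sqrt
    push_cast
    exact hLk
  refine (measure_exists_left_ker_le hkn hX hm hκ0 hκ (b := b) (p := C * √L / √n) (by positivity)
    (hmono n (Nat.sub_le _ _)) (hmono (n - 1) (Nat.sub_le_sub_left (Nat.le_add_left 1 k) n)) ?_).trans (ENNReal.ofReal_le_ofReal ?_)
  · intro i w hw
    refine (hLO (fun j => X i j) ?_ (fun j => hm _ _) (fun j x => hκ _ _ _) w 0 (k + 1) (Nat.le_add_left 1 k)
      hw).trans (ENNReal.ofReal_le_ofReal hpk)
    exact hX.precomp (g := fun j : Fin n => (i, j)) (fun a c h => by simpa using h)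
  · have h1 : n * (b + C * √L / √n) / (k + 1) ≤ L * (b + C * √L / √n) := by
      rw [div_le_iff₀ (by positivity)]
      have : 0 ≤ b + C * √L / √n := by positivity
      nlinarith
    calc _ ≤ b + L * (b + C * √L / √n) := by linarith
      _ = _ := by rw [hb]; ring

end Ginibre

/-! ### The quadratic Littlewood–Offord inequality -/

section Quadratic

variable {Ω : Type*} [MeasurableSpace Ω] {μ : Measure Ω} [IsProbabilityMeasure μ]

lemma lintegral_sq_le {f : Ω → ENNReal} (hf : Measurable f) :
    (∫⁻ ω, f ω ∂μ) ^ 2 ≤ ∫⁻ ω, f ω ^ 2 ∂μ := by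
  have h := ENNReal.lintegral_mul_le_Lp_mul_Lq μ Real.HolderConjugate.two_two hf.aemeasurable
    (measurable_const (a := (1 : ENNReal))).aemeasurable
  simp only [Pi.mul_apply, mul_one, lintegral_const, measure_univ, ENNReal.rpow_two, one_pow,
    ENNReal.one_rpow] at h
  calc (∫⁻ ω, f ω ∂μ) ^ 2 ≤ ((∫⁻ ω, f ω ^ 2 ∂μ) ^ (1 / 2 : ℝ)) ^ 2 := by gcongr
    _ = _ := by
      rw [← ENNReal.rpow_natCast, ← ENNReal.rpow_mul]
      norm_num

/-- Decoupling: two copies of the second variable against a common first variable. -/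
lemma measure_sq_le_decoupled {α β : Type*} [MeasurableSpace α] [MeasurableSpace β]
    {U : Ω → α} {Y : Ω → β} (h : IndepFun U Y μ) (hU : Measurable U)
    (hY : Measurable Y) {A : Set (α × β)} (hA : MeasurableSet A) :
    μ {ω | (U ω, Y ω) ∈ A} ^ 2 ≤
      ∫⁻ ω', ∫⁻ ω'', μ {ω | (U ω, Y ω') ∈ A ∧ (U ω, Y ω'') ∈ A} ∂μ ∂μ := by
  let g : Ω → Ω → ENNReal := fun ω ω' => A.indicator 1 (U ω, Y ω')
  have hgm : Measurable fun p : Ω × Ω => g p.1 p.2 :=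
    (measurable_one.indicator hA).comp
      ((hU.comp measurable_fst).prodMk (hY.comp measurable_snd))
  have hgm' : ∀ ω, Measurable fun ω' => g ω ω' := fun ω => hgm.comp measurable_prodMk_left
  have h1 : ∀ ω, μ {ω' | (U ω, Y ω') ∈ A} = ∫⁻ ω', g ω ω' ∂μ := fun ω =>
    (lintegral_indicator_one (μ := μ) (s := {ω' | (U ω, Y ω') ∈ A})
      ((measurable_const.prodMk hY) hA)).symm
  rw [measure_indepFun h hU hY hA]
  simp_rw [h1]
  refine (lintegral_sq_le (Measurable.lintegral_prod_right' (f := fun p : Ω × Ω => g p.1 p.2)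
    hgm)).trans (le_of_eq ?_)
  calc ∫⁻ ω, (∫⁻ ω', g ω ω' ∂μ) ^ 2 ∂μ
      = ∫⁻ ω, ∫⁻ ω', g ω ω' * ∫⁻ ω'', g ω ω'' ∂μ ∂μ ∂μ := by
        refine lintegral_congr fun ω => ?_
        rw [lintegral_mul_const _ (hgm' ω), sq]
    _ = ∫⁻ ω', ∫⁻ ω, g ω ω' * ∫⁻ ω'', g ω ω'' ∂μ ∂μ ∂μ := by
        refine lintegral_lintegral_swap (Measurable.aemeasurable ?_)
        exact hgm.mul ((Measurable.lintegral_prod_right' (f := fun p : Ω × Ω => g p.1 p.2)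
          hgm).comp measurable_fst)
    _ = ∫⁻ ω', ∫⁻ ω, ∫⁻ ω'', g ω ω' * g ω ω'' ∂μ ∂μ ∂μ := by
        refine lintegral_congr fun ω' => lintegral_congr fun ω => ?_
        rw [lintegral_const_mul _ (hgm' ω)]
    _ = ∫⁻ ω', ∫⁻ ω'', ∫⁻ ω, g ω ω' * g ω ω'' ∂μ ∂μ ∂μ := by
        refine lintegral_congr fun ω' => lintegral_lintegral_swap (Measurable.aemeasurable ?_)
        exact (hgm.comp (measurable_fst.prodMk measurable_const)).mul hgm
    _ = _ := by
        refine lintegral_congr fun ω' => lintegral_congr fun ω'' => ?_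
        have hm : MeasurableSet {ω | (U ω, Y ω') ∈ A ∧ (U ω, Y ω'') ∈ A} :=
          ((hU.prodMk measurable_const) hA).inter ((hU.prodMk measurable_const) hA)
        rw [← lintegral_indicator_one hm]
        refine lintegral_congr fun ω => ?_
        by_cases h1 : (U ω, Y ω') ∈ A <;> by_cases h2 : (U ω, Y ω'') ∈ A <;>
          simp [g, h1, h2, Set.indicator]

variable {ι : Type} [Fintype ι] [DecidableEq ι]

/-- The quadratic form of a symmetric `B` after splitting the coordinates along `S`. -/
noncomputable def splitQuadratic (B : ι → ι → ℝ) (S : Finset ι) (x : S → ℝ)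
    (y : {j // j ∉ S} → ℝ) : ℝ :=
  ∑ i : S, ∑ i' : S, B i i' * x i * x i' + 2 * ∑ i : S, (∑ j : {j // j ∉ S}, B i j * y j) * x i +
    ∑ j : {j // j ∉ S}, ∑ j' : {j // j ∉ S}, B j j' * y j * y j'

lemma sum_eq_splitQuadratic {B : ι → ι → ℝ} (hB : ∀ i j, B i j = B j i) (S : Finset ι)
    (z : ι → ℝ) : ∑ i, ∑ j, B i j * z i * z j =
      splitQuadratic B S (fun i => z i) (fun j => z j) := by
  have hs : ∀ f : ι → ℝ, ∑ i, f i = ∑ i : S, f i + ∑ j : {j // j ∉ S}, f j := by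
    intro f
    convert (Fintype.sum_subtype_add_sum_subtype (fun i => i ∈ S) f).symm
  have hcross : ∑ j : {j // j ∉ S}, ∑ i : S, B j i * z j * z i =
      ∑ i : S, (∑ j : {j // j ∉ S}, B i j * z j) * z i := by
    rw [Finset.sum_comm]
    refine Finset.sum_congr rfl fun i _ => ?_
    rw [Finset.sum_mul]
    exact Finset.sum_congr rfl fun j _ => by rw [hB j i]
  have hcross' : ∑ i : S, ∑ j : {j // j ∉ S}, B i j * z i * z j =
      ∑ i : S, (∑ j : {j // j ∉ S}, B i j * z j) * z i := by
    refine Finset.sum_congr rfl fun i _ => ?_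
    rw [Finset.sum_mul]
    exact Finset.sum_congr rfl fun j _ => by ring
  rw [hs, Finset.sum_congr rfl fun (i : S) _ => hs (fun j => B i j * z i * z j),
    Finset.sum_congr rfl fun (j : {j // j ∉ S}) _ => hs (fun i => B j i * z j * z i),
    Finset.sum_add_distrib, Finset.sum_add_distrib, hcross, hcross', splitQuadratic]
  ring

lemma splitQuadratic_sub (B : ι → ι → ℝ) (S : Finset ι) (x : S → ℝ)
    (y y' : {j // j ∉ S} → ℝ) :
    splitQuadratic B S x y - splitQuadratic B S x y' =
      2 * ∑ i : S, (∑ j : {j // j ∉ S}, B i j * (y j - y' j)) * x i +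
        (∑ j : {j // j ∉ S}, ∑ j' : {j // j ∉ S}, B j j' * y j * y j' -
          ∑ j : {j // j ∉ S}, ∑ j' : {j // j ∉ S}, B j j' * y' j * y' j') := by
  have : ∑ i : S, (∑ j : {j // j ∉ S}, B i j * (y j - y' j)) * x i =
      ∑ i : S, (∑ j : {j // j ∉ S}, B i j * y j) * x i -
        ∑ i : S, (∑ j : {j // j ∉ S}, B i j * y' j) * x i := by
    rw [← Finset.sum_sub_distrib]
    refine Finset.sum_congr rfl fun i _ => ?_
    rw [← sub_mul, ← Finset.sum_sub_distrib]
    congr 1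
    exact Finset.sum_congr rfl fun j _ => by ring
  rw [this, splitQuadratic, splitQuadratic]
  ring

/-- After decoupling the variables outside `S`, the quadratic event becomes a linear one in the
variables of `S`. Its coefficients are themselves linear forms, at least half of which are
nonzero except with probability `2 * p₂`. -/
lemma measure_quadratic_sq_le {X : ι → Ω → ℝ} (hX : iIndepFun X μ) (hm : ∀ i, Measurable (X i))
    {B : ι → ι → ℝ} (hB : ∀ i j, B i j = B j i) {S : Finset ι} (hS : S.Nonempty)
    {p₁ p₂ : ENNReal}
    (h₁ : ∀ (a : S → ℝ) (c : ℝ), S.card / 2 + 1 ≤ (Finset.univ.filter fun i => a i ≠ 0).card →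
      μ {ω | ∑ i, a i * X i ω = c} ≤ p₁)
    (h₂ : ∀ (i : S) (c : ℝ), μ {ω | ∑ j : {j // j ∉ S}, B i j * X j ω = c} ≤ p₂) (c : ℝ) :
    μ {ω | ∑ i, ∑ j, B i j * X i ω * X j ω = c} ^ 2 ≤ p₁ + 2 * p₂ := by
  set U : Ω → S → ℝ := fun ω i => X i ω
  set Y : Ω → {j // j ∉ S} → ℝ := fun ω j => X j ω
  have hU : Measurable U := measurable_pi_lambda _ fun _ => hm _
  have hY : Measurable Y := measurable_pi_lambda _ fun _ => hm _
  have hind : IndepFun U Y μ := iIndepFun.indepFun_tuple hX hm (fun i : S => (i : ι))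
    (fun j : {j // j ∉ S} => (j : ι)) (fun i j h => j.2 (h ▸ i.2))
  let A : Set ((S → ℝ) × ({j // j ∉ S} → ℝ)) := {p | splitQuadratic B S p.1 p.2 = c}
  have hA : MeasurableSet A := by
    refine measurableSet_eq_fun ?_ measurable_const
    unfold splitQuadratic
    fun_prop
  have hset : {ω | ∑ i, ∑ j, B i j * X i ω * X j ω = c} = {ω | (U ω, Y ω) ∈ A} := by
    ext ω
    simp only [Set.mem_ofPred_eq, A]
    rw [sum_eq_splitQuadratic hB S (fun i => X i ω)]
  rw [hset]
  refine (measure_sq_le_decoupled hind hU hY hA).trans ?_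
  have hout : ∀ ω', ∫⁻ ω'', μ {ω | (U ω, Y ω') ∈ A ∧ (U ω, Y ω'') ∈ A} ∂μ ≤ p₁ + 2 * p₂ := by
    intro ω'
    let D : Ω → S → ℝ := fun ω'' i => ∑ j : {j // j ∉ S}, B i j * (Y ω' j - Y ω'' j)
    let E : S → Set Ω := fun i => {ω'' | D ω'' i = 0}
    have hEm : ∀ i, MeasurableSet (E i) := fun i =>
      measurableSet_eq_fun (by fun_prop) measurable_const
    have hE : ∀ i, μ (E i) ≤ p₂ := by
      intro i
      refine le_trans (measure_mono ?_) (h₂ i (∑ j : {j // j ∉ S}, B i j * Y ω' j))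
      intro ω'' hω
      have h : ∑ j : {j // j ∉ S}, B i j * (Y ω' j - Y ω'' j) = 0 := hω
      simp_rw [mul_sub] at h
      rw [Finset.sum_sub_distrib, sub_eq_zero] at h
      exact h.symm
    -- `Z` is the event that at least half of the coefficients vanish
    let Z : Set Ω := {ω'' | (S.card + 1) / 2 ≤ (Finset.univ.filter fun i => D ω'' i = 0).card}
    have hZ : μ Z ≤ 2 * p₂ := by
      have h := mul_measure_le_sum (μ := μ) hEm (K := (S.card + 1) / 2) (B := Z) (fun ω'' hω =>
        ⟨Finset.univ.filter fun i => D ω'' i = 0, hω, fun i hi => (Finset.mem_filter.mp hi).2⟩)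
      have h3 : ∑ i, μ (E i) ≤ (S.card : ENNReal) * p₂ := by
        refine (Finset.sum_le_sum fun i _ => hE i).trans ?_
        simp
      have hpos : 0 < S.card := hS.card_pos
      have h4 : (S.card : ENNReal) * μ Z ≤ S.card * (2 * p₂) := by
        calc (S.card : ENNReal) * μ Z ≤ (2 * ((S.card + 1) / 2 : ℕ) : ENNReal) * μ Z := by
              gcongr
              exact_mod_cast (by omega : S.card ≤ 2 * ((S.card + 1) / 2))
          _ = 2 * (((S.card + 1) / 2 : ℕ) * μ Z) := by ring
          _ ≤ 2 * ((S.card : ENNReal) * p₂) := by gcongr 2 * ?_; exact h.trans h3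
          _ = _ := by ring
      exact (ENNReal.mul_le_mul_iff_right (by exact_mod_cast hpos.ne') (by simp)).mp h4
    have hpt : ∀ ω'', μ {ω | (U ω, Y ω') ∈ A ∧ (U ω, Y ω'') ∈ A} ≤
        p₁ + Z.indicator (fun _ => 1) ω'' := by
      intro ω''
      by_cases hω : ω'' ∈ Z
      · rw [Set.indicator_of_mem hω]
        exact prob_le_one.trans le_add_self
      · rw [Set.indicator_of_notMem hω, add_zero]
        have hcard : S.card / 2 + 1 ≤ (Finset.univ.filter fun i => D ω'' i ≠ 0).card := by
          have h1 : (Finset.univ.filter fun i => D ω'' i = 0).card < (S.card + 1) / 2 :=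
            not_le.mp hω
          have h2 := Finset.card_filter_add_card_filter_not (s := (Finset.univ : Finset S))
            (fun i => D ω'' i = 0)
          rw [Finset.card_univ, Fintype.card_coe] at h2
          change _ + (Finset.univ.filter fun i => D ω'' i ≠ 0).card = _ at h2
          omega
        refine le_trans (measure_mono ?_) (h₁ (D ω'')
          (-(∑ j : {j // j ∉ S}, ∑ j' : {j // j ∉ S}, B j j' * Y ω' j * Y ω' j' -
            ∑ j : {j // j ∉ S}, ∑ j' : {j // j ∉ S}, B j j' * Y ω'' j * Y ω'' j') / 2) hcard)
        rintro ω ⟨ha, hb⟩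
        have ha' : splitQuadratic B S (U ω) (Y ω') = c := ha
        have hb' : splitQuadratic B S (U ω) (Y ω'') = c := hb
        have := splitQuadratic_sub B S (U ω) (Y ω') (Y ω'')
        rw [ha', hb', sub_self] at this
        change ∑ i, D ω'' i * U ω i = _
        simp only [D]
        linarith
    calc _ ≤ ∫⁻ ω'', (p₁ + Z.indicator (fun _ => 1) ω'') ∂μ := lintegral_mono hpt
      _ = p₁ + ∫⁻ ω'', Z.indicator (fun _ => 1) ω'' ∂μ := by
        rw [lintegral_add_left measurable_const]; simp
      _ ≤ p₁ + 1 * μ Z := by gcongr; exact lintegral_indicator_const_le _ _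
      _ ≤ p₁ + 2 * p₂ := by rw [one_mul]; gcongr
  calc _ ≤ ∫⁻ _, (p₁ + 2 * p₂) ∂μ := lintegral_mono hout
    _ = _ := by simp

/-- The quadratic Littlewood–Offord inequality: if each row of `B` has at least `K` nonzero entries,
the quadratic form of `B` hits a given value with probability `O(K ^ (-1/4))`. -/
theorem exists_measure_quadratic_eq_le {κ : ℝ} (hκ0 : 0 ≤ κ) (hκ1 : κ < 1) :
    ∃ C : ℝ, 0 < C ∧ ∀ {Ω : Type*} [MeasurableSpace Ω] {μ : Measure Ω}
      [IsProbabilityMeasure μ] {ι : Type} [Fintype ι] (X : ι → Ω → ℝ), iIndepFun X μ →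
      (∀ i, Measurable (X i)) → (∀ i x, μ {ω | X i ω = x} ≤ ENNReal.ofReal κ) →
      ∀ (B : ι → ι → ℝ), (∀ i j, B i j = B j i) → ∀ (K : ℕ), 1 ≤ K → K ≤ Fintype.card ι →
        (∀ i, K ≤ supportCard (B i)) → ∀ c : ℝ,
        μ {ω | ∑ i, ∑ j, B i j * X i ω * X j ω = c} ≤ ENNReal.ofReal (C / √√K) := by
  obtain ⟨C, hC, hLO⟩ := exists_measure_sum_eq_le hκ0 hκ1
  refine ⟨√(6 * C) + 1, by positivity, ?_⟩
  intro Ω _ μ _ ι _ X hX hm hκ B hB K hK1 hKι hBK c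
  classical
  rcases Nat.lt_or_ge K 2 with hK2 | hK2
  · have : K = 1 := by omega
    subst this
    refine prob_le_one.trans ?_
    rw [ENNReal.one_le_ofReal]
    simp
  have hKR : (0 : ℝ) < K := by exact_mod_cast hK1
  -- `S` takes half of the `K` guaranteed nonzero entries of a row, so that about `K / 2` of them
  -- are left outside `S`
  obtain ⟨S, hSc⟩ := Finset.exists_subset_card_eq (s := (Finset.univ : Finset ι))
    (n := (K + 1) / 2) (by rw [Finset.card_univ]; omega)
  have hSc := hSc.2
  have hS : S.Nonempty := Finset.card_pos.mp (by omega)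
  have hsq := measure_quadratic_sq_le hX hm hB hS (p₁ := ENNReal.ofReal (2 * C / √K))
    (p₂ := ENNReal.ofReal (2 * C / √K)) ?_ ?_ c
  · have h : μ {ω | ∑ i, ∑ j, B i j * X i ω * X j ω = c} ^ 2 ≤
        ENNReal.ofReal (√(6 * C) / √√K) ^ 2 := by
      refine hsq.trans (le_of_eq ?_)
      rw [← ENNReal.ofReal_pow (by positivity), div_pow, Real.sq_sqrt (by positivity),
        Real.sq_sqrt (by positivity), show (2 : ENNReal) = ENNReal.ofReal 2 by simp,
        ← ENNReal.ofReal_mul (by positivity), ← ENNReal.ofReal_add (by positivity) (by positivity)]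
      congr 1; ring
    refine ((ENNReal.pow_le_pow_left_iff two_ne_zero).mp h).trans (ENNReal.ofReal_le_ofReal ?_)
    gcongr
    linarith
  · intro a c' ha
    refine (hLO (fun i : S => X i) (hX.precomp Subtype.val_injective) (fun _ => hm _)
      (fun _ _ => hκ _ _) a c' _ (Nat.le_add_left 1 _) ha).trans (ENNReal.ofReal_le_ofReal ?_)
    have h4 : (K : ℝ) ≤ 4 * ((S.card / 2 + 1 : ℕ) : ℝ) := by
      exact_mod_cast (by omega : K ≤ 4 * (S.card / 2 + 1))
    rw [div_le_div_iff₀ (by positivity) (by positivity)]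
    have : √(K : ℝ) ≤ 2 * √((S.card / 2 + 1 : ℕ) : ℝ) := by
      rw [Real.sqrt_le_left (by positivity), mul_pow, Real.sq_sqrt (by positivity)]
      linarith
    nlinarith
  · intro i c'
    have hcard : K / 2 ≤ (Finset.univ.filter fun j : {j // j ∉ S} => B i j ≠ 0).card := by
      have h1 : (Finset.univ.filter fun j : {j // j ∉ S} => B i j ≠ 0).card =
          ((Finset.univ.filter fun j => B i j ≠ 0) \ S).card := by
        rw [← Finset.card_map (Function.Embedding.subtype _)]
        congr 1
        ext j
        simp [and_comm]
      have h2 := Finset.le_card_sdiff S (Finset.univ.filter fun j => B i j ≠ 0)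
      have h3 := hBK i
      unfold supportCard at h3
      omega
    refine (hLO (fun j : {j // j ∉ S} => X j) (hX.precomp Subtype.val_injective) (fun _ => hm _)
      (fun _ _ => hκ _ _) (fun j => B i j) c' (K / 2) (by omega) hcard).trans
      (ENNReal.ofReal_le_ofReal ?_)
    have h4 : (K : ℝ) ≤ 4 * ((K / 2 : ℕ) : ℝ) := by
      exact_mod_cast (by omega : K ≤ 4 * (K / 2))
    have h5 : (0 : ℝ) < ((K / 2 : ℕ) : ℝ) := by exact_mod_cast (by omega : 0 < K / 2)
    rw [div_le_div_iff₀ (by positivity) (by positivity)]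
    have : √(K : ℝ) ≤ 2 * √((K / 2 : ℕ) : ℝ) := by
      rw [Real.sqrt_le_left (by positivity), mul_pow, Real.sq_sqrt h5.le]
      linarith
    nlinarith

end Quadratic

/-! ### The nullity of a bordered symmetric matrix -/

section Nullity

/-- The dimension of the kernel of a square array of real numbers. -/
noncomputable def nullity {n : ℕ} (M : Fin n → Fin n → ℝ) : ℕ := n - (Matrix.of M).rank

lemma nullity_eq_finrank_ker {n : ℕ} (M : Fin n → Fin n → ℝ) :
    nullity M = Module.finrank ℝ (LinearMap.ker (Matrix.of M).mulVecLin) := by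
  have h := LinearMap.finrank_range_add_finrank_ker (Matrix.of M).mulVecLin
  rw [Module.finrank_fintype_fun_eq_card, Fintype.card_fin] at h
  rw [nullity, Matrix.rank]
  omega

lemma nullity_le {n : ℕ} (M : Fin n → Fin n → ℝ) : nullity M ≤ n := Nat.sub_le _ _

lemma mem_ker_iff_forall_sum {n : ℕ} {M : Fin n → Fin n → ℝ} {v : Fin n → ℝ} :
    v ∈ LinearMap.ker (Matrix.of M).mulVecLin ↔ ∀ i, ∑ j, M i j * v j = 0 := by
  rw [LinearMap.mem_ker, Matrix.mulVecLin_apply, funext_iff]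
  rfl

lemma nullity_ne_zero_iff {n : ℕ} {M : Fin n → Fin n → ℝ} :
    nullity M ≠ 0 ↔ ∃ v : Fin n → ℝ, v ≠ 0 ∧ ∀ i, ∑ j, M i j * v j = 0 := by
  rw [nullity_eq_finrank_ker, ne_eq, Submodule.finrank_eq_zero, ← ne_eq, Submodule.ne_bot_iff]
  simp only [mem_ker_iff_forall_sum]
  exact exists_congr fun v => and_comm

/-- The rank is lower semicontinuous: it is at least `r` when some `r` columns are independent,
which is an open condition. -/
lemma measurable_nullity {n : ℕ} : Measurable (nullity (n := n)) := by
  refine measurable_to_countable' fun c => ?_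
  have hge : ∀ r : ℕ, MeasurableSet {M : Fin n → Fin n → ℝ | r ≤ (Matrix.of M).rank} := by
    intro r
    have h : {M : Fin n → Fin n → ℝ | r ≤ (Matrix.of M).rank} =
        ⋃ f : Fin r → Fin n, {M | LinearIndependent ℝ fun s i => M i (f s)} := by
      ext M
      simp only [Set.mem_ofPred_eq, Set.mem_iUnion]
      constructor
      · intro hr
        rw [Matrix.rank_eq_finrank_span_cols] at hr
        obtain ⟨g, hg, _, hgi⟩ := Submodule.exists_fun_fin_finrank_span_eq ℝ
          (Set.range (Matrix.of M).col)
        choose f hf using hg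
        refine ⟨fun s => f (Fin.castLE hr s), ?_⟩
        have h1 := hgi.comp (Fin.castLE hr) (Fin.castLE_injective hr)
        have e : (fun (s : Fin r) i => M i (f (Fin.castLE hr s))) = g ∘ Fin.castLE hr := by
          ext s i
          exact congrFun (hf (Fin.castLE hr s)) i
        rw [e]
        exact h1
      · rintro ⟨f, hf⟩
        rw [Matrix.rank_eq_finrank_span_cols]
        have h1 := finrank_span_eq_card hf
        rw [Fintype.card_fin] at h1
        rw [← h1]
        refine Submodule.finrank_mono (Submodule.span_mono ?_)
        rintro _ ⟨s, rfl⟩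
        exact ⟨f s, rfl⟩
    rw [h]
    refine MeasurableSet.iUnion fun f => IsOpen.measurableSet ?_
    refine isOpen_setOfPred_linearIndependent.preimage
      (f := fun (M : Fin n → Fin n → ℝ) (s : Fin r) (i : Fin n) => M i (f s)) ?_
    fun_prop
  have heq : ∀ r : ℕ, MeasurableSet {M : Fin n → Fin n → ℝ | (Matrix.of M).rank = r} := by
    intro r
    convert (hge r).diff (hge (r + 1)) using 1
    ext M
    simp only [Set.mem_ofPred_eq, Set.mem_sdiff]
    omega
  have : nullity ⁻¹' {c} = ⋃ r ∈ {r : ℕ | n - r = c},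
      {M : Fin n → Fin n → ℝ | (Matrix.of M).rank = r} := by
    ext M
    simp [nullity]
  rw [this]
  exact MeasurableSet.biUnion (Set.to_countable _) fun r _ => heq r

/-- The symmetric extension of `M` by a last row and column `x` with corner `d`. -/
def border {n : ℕ} (M : Fin n → Fin n → ℝ) (d : ℝ) (x : Fin n → ℝ) :
    Fin (n + 1) → Fin (n + 1) → ℝ :=
  Fin.snoc (α := fun _ => Fin (n + 1) → ℝ) (fun i => Fin.snoc (α := fun _ => ℝ) (M i) (x i))
    (Fin.snoc (α := fun _ => ℝ) x d)

@[simp] lemma border_castSucc_castSucc {n : ℕ} (M : Fin n → Fin n → ℝ) (d : ℝ) (x : Fin n → ℝ)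
    (i j : Fin n) : border M d x i.castSucc j.castSucc = M i j := by simp [border]

@[simp] lemma border_castSucc_last {n : ℕ} (M : Fin n → Fin n → ℝ) (d : ℝ) (x : Fin n → ℝ)
    (i : Fin n) : border M d x i.castSucc (Fin.last n) = x i := by simp [border]

@[simp] lemma border_last_castSucc {n : ℕ} (M : Fin n → Fin n → ℝ) (d : ℝ) (x : Fin n → ℝ)
    (i : Fin n) : border M d x (Fin.last n) i.castSucc = x i := by simp [border]

@[simp] lemma border_last_last {n : ℕ} (M : Fin n → Fin n → ℝ) (d : ℝ) (x : Fin n → ℝ) :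
    border M d x (Fin.last n) (Fin.last n) = d := by simp [border]

lemma measurable_border {n : ℕ} :
    Measurable fun p : ((Fin n → Fin n → ℝ) × ℝ) × (Fin n → ℝ) => border p.1.1 p.1.2 p.2 := by
  refine measurable_pi_lambda _ fun i => measurable_pi_lambda _ fun j => ?_
  induction i using Fin.lastCases with
  | last => induction j using Fin.lastCases with
    | last => simp only [border_last_last]; fun_prop
    | cast j => simp only [border_last_castSucc]; fun_prop
  | cast i => induction j using Fin.lastCases with
    | last => simp only [border_castSucc_last]; fun_prop
    | cast j => simp only [border_castSucc_castSucc]; fun_prop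

lemma nullity_border_le {n : ℕ} (M : Fin n → Fin n → ℝ) (d : ℝ) (x : Fin n → ℝ) :
    nullity (border M d x) ≤ nullity M + 1 := by
  have h := Matrix.rank_submatrix_le (Matrix.of (border M d x)) Fin.castSucc Fin.castSucc
  have e : (Matrix.of (border M d x)).submatrix Fin.castSucc Fin.castSucc = Matrix.of M := by
    ext i j; simp
  rw [e] at h
  unfold nullity
  omega

lemma mem_ker_border {n : ℕ} {M : Fin n → Fin n → ℝ} {d : ℝ} {x : Fin n → ℝ}
    {v : Fin (n + 1) → ℝ} :
    (∀ i, ∑ j, border M d x i j * v j = 0) ↔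
      (∀ i, ∑ j, M i j * v j.castSucc + x i * v (Fin.last n) = 0) ∧
        ∑ j, x j * v j.castSucc + d * v (Fin.last n) = 0 := by
  rw [Fin.forall_fin_succ']
  simp [Fin.sum_univ_castSucc]

lemma sum_mul_sum_symm {n : ℕ} {M : Fin n → Fin n → ℝ} (hM : ∀ i j, M i j = M j i)
    (v u : Fin n → ℝ) : ∑ i, v i * ∑ j, M i j * u j = ∑ j, u j * ∑ i, M j i * v i := by
  simp_rw [Finset.mul_sum]
  rw [Finset.sum_comm]
  exact Finset.sum_congr rfl fun j _ => Finset.sum_congr rfl fun i _ => by rw [hM j i]; ring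

/-- A border that is not orthogonal to the kernel lowers the nullity. -/
lemma nullity_border_lt {n : ℕ} {M : Fin n → Fin n → ℝ} (hM : ∀ i j, M i j = M j i) (d : ℝ)
    {x v : Fin n → ℝ} (hv : ∀ i, ∑ j, M i j * v j = 0) (hx : ∑ i, v i * x i ≠ 0) :
    nullity (border M d x) < nullity M := by
  rw [nullity_eq_finrank_ker, nullity_eq_finrank_ker]
  set N' := LinearMap.ker (Matrix.of (border M d x)).mulVecLin
  set N := LinearMap.ker (Matrix.of M).mulVecLin
  let ℓ : (Fin n → ℝ) →ₗ[ℝ] ℝ := ∑ i, x i • LinearMap.proj i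
  have hℓ : ∀ u, ℓ u = ∑ i, x i * u i := by
    intro u; simp [ℓ, LinearMap.sum_apply]
  have hlast : ∀ w ∈ N', w (Fin.last n) = 0 := by
    intro w hw
    have h1 := (mem_ker_border.mp (mem_ker_iff_forall_sum.mp hw)).1
    have h2 : ∑ i, v i * (∑ j, M i j * w j.castSucc + x i * w (Fin.last n)) = 0 :=
      Finset.sum_eq_zero fun i _ => by rw [h1 i, mul_zero]
    simp_rw [mul_add] at h2
    rw [Finset.sum_add_distrib, sum_mul_sum_symm hM] at h2
    simp only [hv, mul_zero, Finset.sum_const_zero, zero_add] at h2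
    have h3 : (∑ i, v i * x i) * w (Fin.last n) = 0 := by
      rw [Finset.sum_mul, ← h2]
      exact Finset.sum_congr rfl fun i _ => by ring
    exact (mul_eq_zero.mp h3).resolve_left hx
  have hmem : ∀ w : N', LinearMap.funLeft ℝ ℝ Fin.castSucc (w : Fin (n + 1) → ℝ) ∈
      N ⊓ LinearMap.ker ℓ := by
    rintro ⟨w, hw⟩
    have h0 := hlast w hw
    have h1 := mem_ker_border.mp (mem_ker_iff_forall_sum.mp hw)
    rw [h0] at h1
    simp only [mul_zero, add_zero] at h1
    exact ⟨mem_ker_iff_forall_sum.mpr h1.1, LinearMap.mem_ker.mpr ((hℓ _).trans h1.2)⟩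
  let f : N' →ₗ[ℝ] (N ⊓ LinearMap.ker ℓ : Submodule ℝ (Fin n → ℝ)) :=
    ((LinearMap.funLeft ℝ ℝ Fin.castSucc).domRestrict N').codRestrict _ hmem
  have hf : Function.Injective f := by
    rw [← LinearMap.ker_eq_bot, LinearMap.ker_eq_bot']
    rintro ⟨w, hw⟩ h
    have h1 : ∀ i : Fin n, w i.castSucc = 0 := fun i => congrFun (congrArg Subtype.val h) i
    ext i
    induction i using Fin.lastCases with
    | last => exact hlast w hw
    | cast i => exact h1 i
  refine lt_of_le_of_lt (LinearMap.finrank_le_finrank_of_injective hf)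
    (Submodule.finrank_lt_finrank_of_lt (lt_of_le_of_ne inf_le_left fun h => hx ?_))
  have h1 : v ∈ N ⊓ LinearMap.ker ℓ := by rw [h]; exact mem_ker_iff_forall_sum.mpr hv
  have h2 : ℓ v = 0 := h1.2
  rw [← h2, hℓ]
  exact Finset.sum_congr rfl fun i _ => mul_comm _ _

/-- Bordering a nonsingular matrix gives a singular one only if the corner is the value of the
inverse quadratic form at the border. -/
lemma eq_quadratic_of_nullity_border_ne_zero {n : ℕ} {M B : Fin n → Fin n → ℝ}
    (hB : Matrix.of B * Matrix.of M = 1) {d : ℝ} {x : Fin n → ℝ}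
    (h : nullity (border M d x) ≠ 0) : ∑ i, ∑ j, B i j * x i * x j = d := by
  obtain ⟨w, hw0, hw⟩ := nullity_ne_zero_iff.mp h
  obtain ⟨h1, h2⟩ := mem_ker_border.mp hw
  set u : Fin n → ℝ := fun j => w j.castSucc with hu
  set t := w (Fin.last n)
  have h3 : ∀ i, u i = -t * ∑ j, B i j * x j := by
    have e : (Matrix.of M).mulVec u = -t • x := by
      ext i
      have := h1 i
      simp only [Matrix.mulVec, dotProduct, Matrix.of_apply, Pi.smul_apply, smul_eq_mul]
      linarith
    have e2 : u = (Matrix.of B).mulVec (-t • x) := by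
      rw [← e, Matrix.mulVec_mulVec, hB, Matrix.one_mulVec]
    intro i
    rw [e2, Matrix.mulVec_smul]
    rfl
  have ht : t ≠ 0 := by
    intro ht
    apply hw0
    ext i
    induction i using Fin.lastCases with
    | last => exact ht
    | cast i =>
      have := h3 i
      rw [ht] at this
      simpa using this
  have h4 : ∑ j, x j * u j = -t * ∑ i, ∑ j, B i j * x i * x j := by
    rw [Finset.mul_sum]
    refine Finset.sum_congr rfl fun i _ => ?_
    rw [h3 i, Finset.mul_sum, Finset.mul_sum, Finset.mul_sum]
    exact Finset.sum_congr rfl fun j _ => by ring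
  have h5 : t * (d - ∑ i, ∑ j, B i j * x i * x j) = 0 := by
    have : ∑ j, x j * u j + d * t = 0 := h2
    rw [h4] at this
    linarith
  have := (mul_eq_zero.mp h5).resolve_left ht
  linarith

/-- Some nonzero vector with at most `k` nonzero coordinates is mapped by `M` to a multiple of a
basis vector. Kernel vectors and columns of the inverse are of this kind. -/
def HasSparsePreimage {n : ℕ} (k : ℕ) (M : Fin n → Fin n → ℝ) : Prop :=
  ∃ i₀, ∃ v : Fin n → ℝ, v ≠ 0 ∧ supportCard v ≤ k ∧ ∀ j, j ≠ i₀ → ∑ i, M j i * v i = 0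

lemma measurableSet_hasSparsePreimage {n k : ℕ} (hk : k ≤ n) :
    MeasurableSet {M : Fin n → Fin n → ℝ | HasSparsePreimage k M} := by
  have : {M : Fin n → Fin n → ℝ | HasSparsePreimage k M} = ⋃ i₀ : Fin n,
      (fun (M : Fin n → Fin n → ℝ) (r : {j // j ≠ i₀}) => M r) ⁻¹'
        {x : {j // j ≠ i₀} → Fin n → ℝ | ∃ v : Fin n → ℝ, v ≠ 0 ∧ supportCard v ≤ k ∧
          ∀ r, ∑ i, x r i * v i = 0} := by
    ext M
    simp [HasSparsePreimage]
  rw [this]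
  refine MeasurableSet.iUnion fun i₀ => ?_
  have hm : Measurable fun (M : Fin n → Fin n → ℝ) (r : {j // j ≠ i₀}) => M r := by fun_prop
  exact hm (measurableSet_exists_sparse_ker (by simpa using hk))

lemma lt_supportCard_of_mem_ker {n k : ℕ} {M : Fin n → Fin n → ℝ} (h : ¬ HasSparsePreimage k M)
    {v : Fin n → ℝ} (hv0 : v ≠ 0) (hv : ∀ i, ∑ j, M i j * v j = 0) : k + 1 ≤ supportCard v := by
  obtain ⟨i, _⟩ := Function.ne_iff.mp hv0
  by_contra hc
  exact h ⟨i, v, hv0, by omega, fun j _ => hv j⟩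

lemma exists_symm_inverse {n k : ℕ} {M : Fin n → Fin n → ℝ} (hM : ∀ i j, M i j = M j i)
    (h0 : nullity M = 0) (h : ¬ HasSparsePreimage k M) :
    ∃ B : Fin n → Fin n → ℝ, Matrix.of B * Matrix.of M = 1 ∧ (∀ i j, B i j = B j i) ∧
      ∀ i, k + 1 ≤ supportCard (B i) := by
  have hdet : IsUnit (Matrix.of M).det := by
    rw [isUnit_iff_ne_zero]
    intro hd
    obtain ⟨v, hv0, hv⟩ := Matrix.exists_mulVec_eq_zero_iff.mpr hd
    exact nullity_ne_zero_iff.mpr ⟨v, hv0, fun i => congrFun hv i⟩ h0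
  have hMt : (Matrix.of M).transpose = Matrix.of M := by
    ext i j; exact hM j i
  have hsymm : ∀ i j, (Matrix.of M)⁻¹ i j = (Matrix.of M)⁻¹ j i := by
    intro i j
    have := Matrix.transpose_nonsing_inv (Matrix.of M)
    rw [hMt] at this
    exact congrFun (congrFun this j) i
  refine ⟨fun i j => (Matrix.of M)⁻¹ i j, Matrix.nonsing_inv_mul _ hdet, hsymm, fun i => ?_⟩
  have hmul : ∀ j, ∑ l, M j l * (Matrix.of M)⁻¹ i l = (1 : Matrix (Fin n) (Fin n) ℝ) j i := by
    intro j
    rw [← Matrix.mul_nonsing_inv _ hdet, Matrix.mul_apply]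
    exact Finset.sum_congr rfl fun l _ => by rw [hsymm i l]; rfl
  by_contra hc
  refine h ⟨i, fun l => (Matrix.of M)⁻¹ i l, ?_, Nat.lt_succ_iff.mp (not_le.mp hc), fun j hj => ?_⟩
  · intro h0
    have h1 := hmul i
    rw [Finset.sum_eq_zero fun l _ => by rw [congrFun h0 l]; simp] at h1
    simp at h1
  · rw [hmul j, Matrix.one_apply_ne hj]

end Nullity

/-! ### Symmetric matrices with independent entries -/

/-- The position on or above the diagonal that mirrors `(i, j)`. -/
def upperPosition {n : ℕ} (i j : Fin n) : {p : Fin n × Fin n // p.1 ≤ p.2} :=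
  ⟨(min i j, max i j), min_le_max⟩

/-- A symmetric random array with independent entries on and above the diagonal, none of which has
an atom of mass more than `κ`. -/
structure IsSymmetricIndep {Ω : Type*} [MeasurableSpace Ω] (μ : Measure Ω) (κ : ℝ) {n : ℕ}
    (W : Ω → Fin n → Fin n → ℝ) : Prop where
  measurable_entry : ∀ i j, Measurable fun ω => W ω i j
  symm : ∀ ω i j, W ω i j = W ω j i
  indep : iIndepFun (fun (p : {p : Fin n × Fin n // p.1 ≤ p.2}) (ω : Ω) => W ω p.1.1 p.1.2) μ
  atom_le : ∀ i j x, μ {ω | W ω i j = x} ≤ ENNReal.ofReal κ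

namespace IsSymmetricIndep

variable {Ω : Type*} [MeasurableSpace Ω] {μ : Measure Ω} {κ : ℝ} {n : ℕ}

lemma apply_upperPosition {W : Ω → Fin n → Fin n → ℝ} (h : IsSymmetricIndep μ κ W) (ω : Ω)
    (i j : Fin n) : W ω (upperPosition i j).1.1 (upperPosition i j).1.2 = W ω i j := by
  rcases le_total i j with hij | hij
  · simp [upperPosition, hij]
  · simp [upperPosition, hij, h.symm ω i j]

lemma measurable {W : Ω → Fin n → Fin n → ℝ} (h : IsSymmetricIndep μ κ W) : Measurable W :=
  measurable_pi_lambda _ fun _ => measurable_pi_lambda _ fun _ => h.measurable_entry _ _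

/-- Entries at positions with different mirror images are independent. -/
lemma indep_family {W : Ω → Fin n → Fin n → ℝ} (h : IsSymmetricIndep μ κ W) {J : Type*}
    (f g : J → Fin n) (hfg : Function.Injective fun s => upperPosition (f s) (g s)) :
    iIndepFun (fun s ω => W ω (f s) (g s)) μ := by
  have h1 := h.indep.precomp hfg
  simpa only [h.apply_upperPosition] using h1

lemma indep_column {W : Ω → Fin (n + 1) → Fin (n + 1) → ℝ} (h : IsSymmetricIndep μ κ W) :
    iIndepFun (fun (i : Fin n) ω => W ω i.castSucc (Fin.last n)) μ := by
  refine h.indep_family (fun i : Fin n => i.castSucc) (fun _ => Fin.last n) fun i j hij => ?_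
  have h1 := congrArg (fun p => p.1.1) hij
  simpa [upperPosition, Fin.le_last] using h1

lemma minor {W : Ω → Fin (n + 1) → Fin (n + 1) → ℝ} (h : IsSymmetricIndep μ κ W) :
    IsSymmetricIndep μ κ fun ω (i j : Fin n) => W ω i.castSucc j.castSucc where
  measurable_entry _ _ := h.measurable_entry _ _
  symm ω _ _ := h.symm ω _ _
  indep := by
    have h1 := h.indep.precomp (g := fun p : {p : Fin n × Fin n // p.1 ≤ p.2} =>
      (⟨(p.1.1.castSucc, p.1.2.castSucc), Fin.castSucc_le_castSucc_iff.mpr p.2⟩ :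
        {p : Fin (n + 1) × Fin (n + 1) // p.1 ≤ p.2})) (by
      intro p q hpq
      simp only [Subtype.mk.injEq, Prod.mk.injEq, Fin.castSucc_inj] at hpq
      exact Subtype.ext (Prod.ext hpq.1 hpq.2))
    exact h1
  atom_le _ _ _ := h.atom_le _ _ _

lemma eq_border {W : Ω → Fin (n + 1) → Fin (n + 1) → ℝ} (h : IsSymmetricIndep μ κ W) (ω : Ω) :
    W ω = border (fun i j : Fin n => W ω i.castSucc j.castSucc) (W ω (Fin.last n) (Fin.last n))
      (fun i => W ω i.castSucc (Fin.last n)) := by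
  ext i j
  induction i using Fin.lastCases with
  | last => induction j using Fin.lastCases with
    | last => simp
    | cast j => simp [h.symm ω (Fin.last n)]
  | cast i => induction j using Fin.lastCases with
    | last => simp
    | cast j => simp

lemma indepFun_minor_column {W : Ω → Fin (n + 1) → Fin (n + 1) → ℝ}
    (h : IsSymmetricIndep μ κ W) :
    IndepFun (fun ω => ((fun i j : Fin n => W ω i.castSucc j.castSucc),
      W ω (Fin.last n) (Fin.last n))) (fun ω (i : Fin n) => W ω i.castSucc (Fin.last n)) μ := by
  have h1 := iIndepFun.indepFun_tuple h.indep (fun _ => h.measurable_entry _ _)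
    (Sum.elim (fun p : Fin n × Fin n => upperPosition p.1.castSucc p.2.castSucc)
      (fun _ : Unit => upperPosition (Fin.last n) (Fin.last n)))
    (fun i : Fin n => upperPosition i.castSucc (Fin.last n)) (by
      rintro (p | _) i hpi
      · have h2 := congrArg (fun p => p.1.2) hpi
        simp only [Sum.elim_inl, upperPosition, Fin.le_last, sup_of_le_right] at h2
        rcases max_choice p.1.castSucc p.2.castSucc with h3 | h3 <;> rw [h3] at h2 <;>
          exact (Fin.castSucc_lt_last _).ne h2
      · have h2 := congrArg (fun p => p.1.1) hpi
        simp only [Sum.elim_inr, upperPosition, Fin.le_last, inf_of_le_left] at h2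
        exact (Fin.castSucc_lt_last _).ne h2.symm)
  have h3 := h1.comp (φ := fun y => ((fun i j : Fin n => y (Sum.inl (i, j))), y (Sum.inr ())))
    (ψ := id) (by fun_prop) measurable_id
  convert h3 using 1
  · ext ω i j
    · simp [h.apply_upperPosition]
    · simp [h.apply_upperPosition]
  · ext ω i
    simp [h.apply_upperPosition]

/-- Rows outside a set `T` of coordinates, restricted to `T`, form a rectangular matrix with
independent entries, so that vectors supported in `T` can be treated as for general matrices. -/
lemma measure_hasSparsePreimage_le [IsProbabilityMeasure μ] (hκ0 : 0 ≤ κ) (hκ1 : κ < 1)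
    {W : Ω → Fin n → Fin n → ℝ} (h : IsSymmetricIndep μ κ W) {k : ℕ} (hk : k ≤ n) :
    μ {ω | HasSparsePreimage k (W ω)} ≤
      ENNReal.ofReal (n * (n.choose k * (2 ^ k * ((1 + κ) / 2) ^ (n - (k + 1))))) := by
  have hset : {ω | HasSparsePreimage k (W ω)} = ⋃ i₀ : Fin n, {ω | ∃ v : Fin n → ℝ, v ≠ 0 ∧
      supportCard v ≤ k ∧ ∀ j, j ≠ i₀ → ∑ i, W ω j i * v i = 0} := by
    ext ω; simp [HasSparsePreimage]
  rw [hset]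
  refine (measure_iUnion_fintype_le _ _).trans ?_
  rw [ENNReal.ofReal_mul (by positivity), ENNReal.ofReal_natCast]
  have hi : ∀ i₀ : Fin n, μ {ω | ∃ v : Fin n → ℝ, v ≠ 0 ∧
      supportCard v ≤ k ∧ ∀ j, j ≠ i₀ → ∑ i, W ω j i * v i = 0} ≤
        ENNReal.ofReal (n.choose k * (2 ^ k * ((1 + κ) / 2) ^ (n - (k + 1)))) := by
    intro i₀
    rw [ENNReal.ofReal_mul (by positivity), ENNReal.ofReal_natCast]
    have h1 := measure_exists_sparse_le (μ := μ) (ι := Fin n) (k := k) (by simpa using hk)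
      (fun ω v => ∀ j, j ≠ i₀ → ∑ i, W ω j i * v i = 0)
      (b := ENNReal.ofReal (2 ^ k * ((1 + κ) / 2) ^ (n - (k + 1)))) ?_
    · rwa [Fintype.card_fin] at h1
    intro T hT
    have hind : iIndepFun (fun (p : {j // j ∉ insert i₀ T} × T) ω => W ω p.1 p.2) μ := by
      refine h.indep_family (fun p : {j // j ∉ insert i₀ T} × T => (p.1 : Fin n))
        (fun p => (p.2 : Fin n)) ?_
      rintro ⟨⟨r, hr⟩, ⟨s, hs⟩⟩ ⟨⟨r', hr'⟩, ⟨s', hs'⟩⟩ hp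
      have hrs : r ≠ s' := fun e => hr (e ▸ Finset.mem_insert_of_mem hs')
      have hsr : s ≠ r' := fun e => hr' (e ▸ Finset.mem_insert_of_mem hs)
      simp only [upperPosition, Subtype.mk.injEq, Prod.mk.injEq] at hp ⊢
      rcases le_total r s with h1 | h1 <;> rcases le_total r' s' with h2 | h2 <;>
        simp only [h1, h2, inf_of_le_left, inf_of_le_right, sup_of_le_left, sup_of_le_right] at hp
      · exact hp
      · exact absurd hp.1 hrs
      · exact absurd hp.1 hsr
      · exact hp.symm
    have h1 := measure_exists_ker_le (μ := μ) hκ0 (R := {j // j ∉ insert i₀ T}) (S := T)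
      (X := fun r s ω => W ω r s) hind (fun _ _ => h.measurable_entry _ _)
      (fun _ _ _ => h.atom_le _ _ _)
    rw [Fintype.card_coe, hT] at h1
    have hcard : n - (k + 1) ≤ Fintype.card {j // j ∉ insert i₀ T} := by
      rw [Fintype.card_subtype_compl, Fintype.card_fin, Fintype.card_coe]
      have := Finset.card_insert_le i₀ T
      omega
    refine le_trans (measure_mono ?_) (h1.trans (ENNReal.ofReal_le_ofReal ?_))
    · rintro ω ⟨v, hv0, hvT, hv⟩
      refine ⟨fun s => v s, restrict_ne_zero hv0 hvT, fun r => ?_⟩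
      rw [← hv r (fun e => r.2 (by rw [e]; exact Finset.mem_insert_self _ _))]
      exact (sum_mul_eq_sum_restrict hvT fun i => W ω r i).symm
    · gcongr _ * ?_
      exact pow_le_pow_of_le_one (by positivity) (by linarith) hcard
  refine (Finset.sum_le_sum fun i₀ _ => hi i₀).trans ?_
  simp

end IsSymmetricIndep

/-! ### One step of the nullity process -/

/-- The exponential potential `b ^ c - 1` of a nullity `c`. -/
noncomputable def potential (b : ℝ) (c : ℕ) : ENNReal := ENNReal.ofReal (b ^ c - 1)

lemma potential_mono {b : ℝ} (hb : 1 ≤ b) : Monotone (potential b) := fun c c' h => by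
  unfold potential
  gcongr

lemma potential_pred_le {b : ℝ} (hb : 1 < b) {c : ℕ} (hc : 1 ≤ c) :
    potential b (c - 1) ≤ ENNReal.ofReal (1 / b) * potential b c := by
  obtain ⟨c, rfl⟩ : ∃ d, c = d + 1 := ⟨c - 1, by omega⟩
  unfold potential
  rw [← ENNReal.ofReal_mul (by positivity)]
  refine ENNReal.ofReal_le_ofReal ?_
  have : 1 / b * (b ^ (c + 1) - 1) = b ^ c - 1 / b := by
    field_simp
    ring
  rw [this, Nat.add_sub_cancel]
  have : 1 / b ≤ 1 := by rw [div_le_one (by linarith)]; exact hb.le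
  linarith

lemma potential_succ_le {b : ℝ} (hb : 1 < b) {c : ℕ} (hc : 1 ≤ c) :
    potential b (c + 1) ≤ ENNReal.ofReal (b + 1) * potential b c := by
  unfold potential
  rw [← ENNReal.ofReal_mul (by positivity)]
  refine ENNReal.ofReal_le_ofReal ?_
  have : b ^ 1 ≤ b ^ c := pow_le_pow_right₀ hb.le hc
  rw [pow_succ]
  nlinarith

lemma potential_le_pow {b : ℝ} (hb : 1 < b) {c m : ℕ} (hc : c ≤ m) :
    potential b c ≤ ENNReal.ofReal (b ^ m) := by
  unfold potential
  refine ENNReal.ofReal_le_ofReal ?_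
  have := pow_le_pow_right₀ hb.le hc
  linarith

/-- If `M` is singular, the new column is not orthogonal to a kernel vector outside an event of
probability `η`, and the nullity drops. If `M` is nonsingular, the nullity becomes `1` only on a
quadratic event of probability `ζ`. -/
lemma lintegral_potential_border_le {Ω : Type*} [MeasurableSpace Ω] {μ : Measure Ω}
    [IsProbabilityMeasure μ] {n k : ℕ} {x : Ω → Fin n → ℝ}
    {b η ζ : ℝ} (hb : 1 < b) (hη0 : 0 ≤ η)
    (hη : ∀ v : Fin n → ℝ, k + 1 ≤ supportCard v → μ {ω | ∑ i, v i * x ω i = 0} ≤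
      ENNReal.ofReal η)
    (hζ : ∀ (B : Fin n → Fin n → ℝ) (c : ℝ), (∀ i j, B i j = B j i) →
      (∀ i, k + 1 ≤ supportCard (B i)) →
        μ {ω | ∑ i, ∑ j, B i j * x ω i * x ω j = c} ≤ ENNReal.ofReal ζ)
    {M : Fin n → Fin n → ℝ} (hM : ∀ i j, M i j = M j i) (d : ℝ) :
    ∫⁻ ω, potential b (nullity (border M d (x ω))) ∂μ ≤
      ENNReal.ofReal (1 / b + (b + 1) * η) * potential b (nullity M) +
        ENNReal.ofReal ((b - 1) * ζ) +
          {M | HasSparsePreimage k M}.indicator (fun _ => ENNReal.ofReal (b ^ (n + 1))) M := by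
  -- on the exceptional set only the trivial bound `n + 1` for the nullity is used
  by_cases hbad : HasSparsePreimage k M
  · rw [Set.indicator_of_mem (by exact hbad)]
    refine le_trans ?_ le_add_self
    calc _ ≤ ∫⁻ _, ENNReal.ofReal (b ^ (n + 1)) ∂μ :=
          lintegral_mono fun ω => potential_le_pow hb (nullity_le _)
      _ = _ := by simp
  rw [Set.indicator_of_notMem (by exact hbad), add_zero]
  by_cases h0 : nullity M = 0
  · refine le_trans ?_ le_add_self
    obtain ⟨B, hBM, hBs, hBk⟩ := exists_symm_inverse hM h0 hbad
    let E : Set Ω := {ω | ∑ i, ∑ j, B i j * x ω i * x ω j = d}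
    have hpt : ∀ ω, potential b (nullity (border M d (x ω))) ≤
        E.indicator (fun _ => ENNReal.ofReal (b - 1)) ω := by
      intro ω
      by_cases hc : nullity (border M d (x ω)) = 0
      · rw [hc]; simp [potential]
      · rw [Set.indicator_of_mem (by exact eq_quadratic_of_nullity_border_ne_zero hBM hc)]
        have h1 := nullity_border_le M d (x ω)
        refine (potential_mono hb.le h1).trans (le_of_eq ?_)
        simp [h0, potential]
    calc _ ≤ ∫⁻ ω, E.indicator (fun _ => ENNReal.ofReal (b - 1)) ω ∂μ := lintegral_mono hpt
      _ ≤ ENNReal.ofReal (b - 1) * μ E := lintegral_indicator_const_le _ _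
      _ ≤ ENNReal.ofReal (b - 1) * ENNReal.ofReal ζ := by gcongr; exact hζ B d hBs hBk
      _ = _ := (ENNReal.ofReal_mul (by linarith)).symm
  · refine le_trans ?_ le_self_add
    obtain ⟨v, hv0, hv⟩ := nullity_ne_zero_iff.mp h0
    have hc1 : 1 ≤ nullity M := Nat.one_le_iff_ne_zero.mpr h0
    let E : Set Ω := {ω | ∑ i, v i * x ω i = 0}
    have hpt : ∀ ω, potential b (nullity (border M d (x ω))) ≤
        potential b (nullity M - 1) + E.indicator (fun _ => potential b (nullity M + 1)) ω := by
      intro ω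
      by_cases hω : ω ∈ E
      · rw [Set.indicator_of_mem hω]
        exact (potential_mono hb.le (nullity_border_le M d (x ω))).trans le_add_self
      · rw [Set.indicator_of_notMem hω, add_zero]
        exact potential_mono hb.le (Nat.le_sub_one_of_lt (nullity_border_lt hM d hv hω))
    calc _ ≤ ∫⁻ ω, (potential b (nullity M - 1) +
          E.indicator (fun _ => potential b (nullity M + 1)) ω) ∂μ := lintegral_mono hpt
      _ = potential b (nullity M - 1) +
          ∫⁻ ω, E.indicator (fun _ => potential b (nullity M + 1)) ω ∂μ := by
        rw [lintegral_add_left measurable_const]; simp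
      _ ≤ potential b (nullity M - 1) + potential b (nullity M + 1) * μ E := by
        gcongr; exact lintegral_indicator_const_le _ _
      _ ≤ ENNReal.ofReal (1 / b) * potential b (nullity M) +
          ENNReal.ofReal (b + 1) * potential b (nullity M) * ENNReal.ofReal η := by
        gcongr
        · exact potential_pred_le hb hc1
        · exact potential_succ_le hb hc1
        · exact hη v (lt_supportCard_of_mem_ker hbad hv0 hv)
      _ = _ := by
        rw [ENNReal.ofReal_add (p := 1 / b) (by positivity) (by positivity),
          ENNReal.ofReal_mul (p := b + 1) (by positivity)]
        ring

/-! ### The expected potential of the nullity -/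

lemma measurable_potential_nullity (b : ℝ) {n : ℕ} :
    Measurable fun M : Fin n → Fin n → ℝ => potential b (nullity M) :=
  (measurable_from_top (f := potential b)).comp measurable_nullity

lemma sqrt_sqrt_pow_four {x : ℝ} (hx : 0 ≤ x) : √√x ^ 4 = x := by
  rw [show √√x ^ 4 = (√√x ^ 2) ^ 2 by ring, Real.sq_sqrt (Real.sqrt_nonneg _), Real.sq_sqrt hx]

/-- A recursion that contracts by nearly `1 / b` and has a source of order `m ^ (-1/4)` keeps its
solution at that order. -/
lemma exists_recursion_bound {b H K : ℝ} (hb : 1 < b) (_ : 0 ≤ H) (_ : 0 ≤ K) :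
    ∃ D : ℝ, 0 < D ∧ ∃ m₀ : ℕ, 1 ≤ m₀ ∧ (∀ m : ℕ, m ≤ m₀ → b ^ m ≤ D / √√(m + 1)) ∧
      ∀ m : ℕ, m₀ ≤ m → (1 / b + H / √(m + 1)) * (D / √√(m + 1)) + K / √√(m + 1) ≤
        D / √√(m + 1 + 1) := by
  set δ : ℝ := 1 - 1 / b with hδ
  have hb0 : 0 < b := by linarith
  have hbi : 0 < 1 / b := by positivity
  have hδ0 : 0 < δ := by
    have : 1 / b < 1 := by rw [div_lt_one hb0]; exact hb
    linarith
  have hδ1 : δ < 1 := by linarith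
  obtain ⟨m₀, hm₀⟩ := exists_nat_ge (max ((4 * H / δ) ^ 2) (4 / δ) + 1)
  have hm1 : (4 * H / δ) ^ 2 ≤ m₀ := by linarith [le_max_left ((4 * H / δ) ^ 2) (4 / δ)]
  have hm2 : 4 / δ ≤ m₀ := by linarith [le_max_right ((4 * H / δ) ^ 2) (4 / δ)]
  have hm3 : (1 : ℝ) ≤ m₀ := by
    have : 0 ≤ 4 / δ := by positivity
    linarith [le_max_right ((4 * H / δ) ^ 2) (4 / δ)]
  set D : ℝ := max (2 * K / δ) (b ^ m₀ * √√(m₀ + 1)) with hD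
  have hD0 : 0 < D := lt_of_lt_of_le (by positivity) (le_max_right _ _)
  -- of the gap `δ = 1 - 1 / b`, a quarter pays for the perturbation `H / √(m + 1)`, a quarter for
  -- the decrease of the target, and the rest for the source `K`
  refine ⟨D, hD0, m₀, by exact_mod_cast hm3, ?_, ?_⟩
  · intro m hm
    rw [le_div_iff₀ (by positivity)]
    refine le_trans ?_ (le_max_right _ _)
    have : (m : ℝ) ≤ m₀ := by exact_mod_cast hm
    gcongr
    exact hb.le
  · intro m hm
    have hmR : (m₀ : ℝ) ≤ m := by exact_mod_cast hm
    set r := √√((m : ℝ) + 1) with hr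
    set r' := √√((m : ℝ) + 1 + 1) with hr'
    have hr0 : 0 < r := by positivity
    have hr'0 : 0 < r' := by positivity
    have h1 : H / √((m : ℝ) + 1) ≤ δ / 4 := by
      rw [div_le_iff₀ (by positivity)]
      have : 4 * H / δ ≤ √((m : ℝ) + 1) := Real.le_sqrt_of_sq_le (by linarith)
      rw [div_le_iff₀ hδ0] at this
      linarith
    have h2 : (1 - δ / 4) * r' ≤ r := by
      refine (pow_le_pow_iff_left₀ (by nlinarith) hr0.le (n := 4) (by norm_num)).mp ?_
      rw [mul_pow, hr, hr', sqrt_sqrt_pow_four (by positivity), sqrt_sqrt_pow_four (by positivity)]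
      have h3 : (1 - δ / 4) ^ 4 ≤ 1 - δ / 4 :=
        pow_le_of_le_one (by linarith) (by linarith) (by norm_num)
      have h4 : 1 ≤ δ / 4 * ((m : ℝ) + 1 + 1) := by
        rw [div_le_iff₀ hδ0] at hm2
        nlinarith
      calc (1 - δ / 4) ^ 4 * ((m : ℝ) + 1 + 1) ≤ (1 - δ / 4) * ((m : ℝ) + 1 + 1) := by gcongr
        _ ≤ _ := by linarith
    have h5 : K ≤ D * (δ / 2) := by
      have := le_max_left (2 * K / δ) (b ^ m₀ * √√((m₀ : ℝ) + 1))
      rw [← hD, div_le_iff₀ hδ0] at this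
      linarith
    have h6 : (1 / b + H / √((m : ℝ) + 1)) * D + K ≤ D * (1 - δ / 4) := by
      have : (1 / b + H / √((m : ℝ) + 1)) * D ≤ (1 - δ + δ / 4) * D := by
        gcongr
        linarith
      nlinarith
    calc (1 / b + H / √((m : ℝ) + 1)) * (D / r) + K / r
        = ((1 / b + H / √((m : ℝ) + 1)) * D + K) / r := by ring
      _ ≤ D * (1 - δ / 4) / r := by gcongr
      _ ≤ D / r' := by
        rw [div_le_div_iff₀ hr0 hr'0, mul_assoc]
        gcongr

/-- The expected potential of the nullity of a symmetric random matrix is `O(n ^ (-1/4))`. -/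
theorem exists_lintegral_potential_nullity_le {κ : ℝ} (hκ0 : 0 ≤ κ) (hκ1 : κ < 1) :
    ∃ b D : ℝ, 1 < b ∧ 0 < D ∧ ∀ {Ω : Type*} [MeasurableSpace Ω] {μ : Measure Ω}
      [IsProbabilityMeasure μ] (n : ℕ) (W : Ω → Fin n → Fin n → ℝ), IsSymmetricIndep μ κ W →
        ∫⁻ ω, potential b (nullity (W ω)) ∂μ ≤ ENNReal.ofReal (D / √√(n + 1)) := by
  set θ : ℝ := (1 + κ) / 2 with hθ
  have hθ0 : 0 < θ := by positivity
  have hθ1 : θ < 1 := by rw [hθ]; linarith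
  obtain ⟨C₁, hC₁, hLO⟩ := exists_measure_sum_eq_le hκ0 hκ1
  obtain ⟨C₂, hC₂, hQ⟩ := exists_measure_quadratic_eq_le hκ0 hκ1
  obtain ⟨L, q, K, hL, hq0, hq1, hK, hcount⟩ := exists_choose_mul_pow_le hθ0 hθ1
  -- with base `b = 1 / s` the potential grows slower than the exceptional events decay
  set s : ℝ := √q with hs
  have hs0 : 0 < s := Real.sqrt_pos.mpr hq0
  have hss : s * s = q := Real.mul_self_sqrt hq0.le
  have hs1 : s < 1 := by nlinarith
  obtain ⟨K', hK', hpow⟩ := exists_pow_le_div_sqrt hs0.le hs1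
  set b : ℝ := 1 / s with hb
  have hb1 : 1 < b := by rw [hb, lt_div_iff₀ hs0]; linarith
  have hbs : b * s = 1 := by rw [hb]; field_simp
  have hbq : b * q = s := by rw [← hss, ← mul_assoc, hbs, one_mul]
  obtain ⟨D, hD, m₀, hm₀, hinit, hrec⟩ := exists_recursion_bound (b := b)
    (H := (b + 1) * (C₁ * √L)) (K := (b - 1) * (C₂ * √√L) + b * K * (K' / s)) hb1
    (by positivity) (by have : 0 < b - 1 := by linarith
                        positivity)
  refine ⟨b, D, hb1, hD, ?_⟩
  intro Ω _ μ _ n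
  induction n with
  | zero =>
    intro W _
    have : ∀ ω, nullity (W ω) = 0 := fun ω => Nat.le_zero.mp (nullity_le _)
    simp [this, potential]
  | succ m ih =>
    intro W hW
    rcases Nat.lt_or_ge m m₀ with hm | hm
    · calc _ ≤ ∫⁻ _, ENNReal.ofReal (b ^ (m + 1)) ∂μ :=
            lintegral_mono fun ω => potential_le_pow hb1 (nullity_le _)
        _ = ENNReal.ofReal (b ^ (m + 1)) := by simp
        _ ≤ _ := ENNReal.ofReal_le_ofReal (hinit (m + 1) hm)
    have hm1 : 1 ≤ m := hm₀.trans hm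
    set k := m / L with hk
    have hkm : k ≤ m := Nat.div_le_self m L
    have hLk : (m : ℝ) + 1 ≤ L * ((k + 1 : ℕ) : ℝ) := by
      have := Nat.lt_mul_div_succ m (show 0 < L by omega)
      exact_mod_cast this
    have hsq : √((m : ℝ) + 1) ≤ √L * √((k + 1 : ℕ) : ℝ) := by
      rw [← Real.sqrt_mul (by positivity)]
      exact Real.sqrt_le_sqrt hLk
    have hsq2 : √√((m : ℝ) + 1) ≤ √√L * √√((k + 1 : ℕ) : ℝ) := by
      rw [← Real.sqrt_mul (by positivity)]
      exact Real.sqrt_le_sqrt hsq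
    have hM := hW.minor
    set M : Ω → Fin m → Fin m → ℝ := fun ω i j => W ω i.castSucc j.castSucc
    set x : Ω → Fin m → ℝ := fun ω i => W ω i.castSucc (Fin.last m)
    set d : Ω → ℝ := fun ω => W ω (Fin.last m) (Fin.last m)
    have hxm : Measurable x := measurable_pi_lambda _ fun _ => hW.measurable_entry _ _
    have hxm' : ∀ i, Measurable fun ω => x ω i := fun _ => hW.measurable_entry _ _
    have hdm : Measurable d := hW.measurable_entry _ _
    have hstep : ∀ (M : Fin m → Fin m → ℝ) (d : ℝ), (∀ i j, M i j = M j i) →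
        ∫⁻ ω, potential b (nullity (border M d (x ω))) ∂μ ≤
          ENNReal.ofReal (1 / b + (b + 1) * (C₁ * √L / √(m + 1))) * potential b (nullity M) +
          ENNReal.ofReal ((b - 1) * (C₂ * √√L / √√(m + 1))) +
          {M | HasSparsePreimage k M}.indicator (fun _ => ENNReal.ofReal (b ^ (m + 1))) M := by
      intro M d hMs
      refine lintegral_potential_border_le hb1 (by positivity) ?_ ?_ hMs d
      · intro v hv
        refine (hLO (fun i ω => x ω i) hW.indep_column hxm' (fun _ _ => hW.atom_le _ _ _) v 0
          (k + 1) (Nat.le_add_left 1 k) hv).trans (ENNReal.ofReal_le_ofReal ?_)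
        rw [div_le_div_iff₀ (by positivity) (by positivity), mul_assoc]
        gcongr
      · intro B c hBs hBk
        have hkm' : k + 1 ≤ Fintype.card (Fin m) :=
          (hBk ⟨0, hm1⟩).trans (Finset.card_le_univ _)
        refine (hQ (fun i ω => x ω i) hW.indep_column hxm' (fun _ _ => hW.atom_le _ _ _) B hBs
          (k + 1) (Nat.le_add_left 1 k) hkm' hBk c).trans (ENNReal.ofReal_le_ofReal ?_)
        rw [div_le_div_iff₀ (by positivity) (by positivity), mul_assoc]
        gcongr
    have hbad : μ {ω | HasSparsePreimage k (M ω)} ≤ ENNReal.ofReal (K * q ^ m) :=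
      (hM.measure_hasSparsePreimage_le hκ0 hκ1 hkm).trans (ENNReal.ofReal_le_ofReal (hcount m))
    have hbadm : MeasurableSet {ω | HasSparsePreimage k (M ω)} :=
      hM.measurable (measurableSet_hasSparsePreimage hkm)
    have hpm : Measurable fun ω => potential b (nullity (M ω)) :=
      (measurable_potential_nullity b).comp hM.measurable
    have hsplit : ∫⁻ ω, potential b (nullity (W ω)) ∂μ =
        ∫⁻ ω, ∫⁻ ω', potential b (nullity (border (M ω) (d ω) (x ω'))) ∂μ ∂μ := by
      have h1 := lintegral_indepFun hW.indepFun_minor_column (hM.measurable.prodMk hdm) hxm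
        (f := fun p : ((Fin m → Fin m → ℝ) × ℝ) × (Fin m → ℝ) =>
          potential b (nullity (border p.1.1 p.1.2 p.2)))
        ((measurable_potential_nullity b).comp measurable_border)
      rw [← h1]
      exact lintegral_congr fun ω =>
        congrArg (fun A => potential b (nullity A)) (hW.eq_border ω)
    set A : ℝ := 1 / b + (b + 1) * (C₁ * √L / √(m + 1)) with hA
    set F : ℝ := (b - 1) * (C₂ * √√L / √√(m + 1)) with hF
    have hF0 : 0 ≤ F := by
      have : 0 < b - 1 := by linarith
      positivity
    have hA0 : 0 ≤ A := by positivity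
    calc ∫⁻ ω, potential b (nullity (W ω)) ∂μ
        ≤ ∫⁻ ω, (ENNReal.ofReal A * potential b (nullity (M ω)) + ENNReal.ofReal F +
          {ω | HasSparsePreimage k (M ω)}.indicator
            (fun _ => ENNReal.ofReal (b ^ (m + 1))) ω) ∂μ := by
          rw [hsplit]
          exact lintegral_mono fun ω => hstep (M ω) (d ω) (hM.symm ω)
      _ = ENNReal.ofReal A * ∫⁻ ω, potential b (nullity (M ω)) ∂μ + ENNReal.ofReal F +
          ENNReal.ofReal (b ^ (m + 1)) * μ {ω | HasSparsePreimage k (M ω)} := by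
          have hm2 : Measurable fun ω => ENNReal.ofReal A * potential b (nullity (M ω)) :=
            hpm.const_mul _
          have hm3 : Measurable fun ω =>
              ENNReal.ofReal A * potential b (nullity (M ω)) + ENNReal.ofReal F :=
            hm2.add measurable_const
          rw [lintegral_add_left hm3, lintegral_add_left hm2, lintegral_const_mul _ hpm,
            lintegral_indicator_const hbadm]
          simp
      _ ≤ ENNReal.ofReal A * ENNReal.ofReal (D / √√(m + 1)) + ENNReal.ofReal F +
          ENNReal.ofReal (b ^ (m + 1)) * ENNReal.ofReal (K * q ^ m) := by
          gcongr
          exact ih M hM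
      _ = ENNReal.ofReal (A * (D / √√(m + 1)) + F + b ^ (m + 1) * (K * q ^ m)) := by
          rw [← ENNReal.ofReal_mul hA0, ← ENNReal.ofReal_mul (by positivity),
            ← ENNReal.ofReal_add (by positivity) hF0,
            ← ENNReal.ofReal_add (by positivity) (by positivity)]
      _ ≤ ENNReal.ofReal (D / √√((m + 1 : ℕ) + 1)) := by
          refine ENNReal.ofReal_le_ofReal ?_
          have hlast : b ^ (m + 1) * (K * q ^ m) ≤ b * K * (K' / s) / √√((m : ℝ) + 1) := by
            have h1 : b ^ (m + 1) * (K * q ^ m) = b * K * (s ^ (m + 1) / s) := by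
              rw [pow_succ, pow_succ s, mul_div_assoc, div_self hs0.ne', mul_one, ← hbq, mul_pow]
              ring
            have h2 := hpow (m + 1) (by omega)
            have h3 : √√((m : ℝ) + 1) ≤ √((m : ℝ) + 1) := by
              rw [Real.sqrt_le_left (by positivity), Real.sq_sqrt (by positivity),
                Real.sqrt_le_left (by positivity)]
              nlinarith [(Nat.cast_nonneg m : (0 : ℝ) ≤ m)]
            have h4 : s ^ (m + 1) ≤ K' / √√((m : ℝ) + 1) := by
              refine h2.trans ?_
              push_cast
              gcongr
            rw [h1, mul_div_assoc, div_right_comm]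
            gcongr
          have h := hrec m hm
          push_cast
          refine le_trans ?_ h
          have e : A = 1 / b + (b + 1) * (C₁ * √L) / √((m : ℝ) + 1) := by rw [hA]; ring
          rw [e, add_div ((b - 1) * (C₂ * √√(L : ℝ)))]
          have e2 : F = (b - 1) * (C₂ * √√(L : ℝ)) / √√((m : ℝ) + 1) := by rw [hF]; ring
          rw [e2]
          linarith

/-- A symmetric random matrix is singular with probability `O(n ^ (-1/4))`. -/
theorem exists_measure_nullity_ne_zero_le {κ : ℝ} (hκ0 : 0 ≤ κ) (hκ1 : κ < 1) :
    ∃ C : ℝ, 0 < C ∧ ∀ {Ω : Type*} [MeasurableSpace Ω] {μ : Measure Ω}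
      [IsProbabilityMeasure μ] (n : ℕ) (W : Ω → Fin n → Fin n → ℝ), IsSymmetricIndep μ κ W →
        μ {ω | nullity (W ω) ≠ 0} ≤ ENNReal.ofReal (C / √√(n + 1)) := by
  obtain ⟨b, D, hb, hD, h⟩ := exists_lintegral_potential_nullity_le hκ0 hκ1
  have hb0 : 0 < b - 1 := by linarith
  refine ⟨D / (b - 1), by positivity, ?_⟩
  intro Ω _ μ _ n W hW
  have hpm : Measurable fun ω => potential b (nullity (W ω)) :=
    (measurable_potential_nullity b).comp hW.measurable
  have h1 : ENNReal.ofReal (b - 1) * μ {ω | nullity (W ω) ≠ 0} ≤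
      ENNReal.ofReal (D / √√(n + 1)) := by
    refine le_trans ?_ (h n W hW)
    refine le_trans ?_ (mul_meas_ge_le_lintegral hpm (ENNReal.ofReal (b - 1)))
    gcongr
    intro hω
    have := potential_mono hb.le (Nat.one_le_iff_ne_zero.mpr hω)
    simpa [potential] using this
  have h2 : ENNReal.ofReal (D / (b - 1) / √√(n + 1)) =
      ENNReal.ofReal (D / √√(n + 1)) / ENNReal.ofReal (b - 1) := by
    rw [← ENNReal.ofReal_div_of_pos hb0]
    congr 1; ring
  rw [h2, ENNReal.le_div_iff_mul_le (Or.inl (by simpa using hb)) (Or.inl ENNReal.ofReal_ne_top),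
    mul_comm]
  exact h1

/-! ### Singularity of Ginibre and Wigner matrices -/

lemma measure_eq_le_of_matrixBiggestJump_lt {Ω : Type*} [MeasurableSpace Ω] {μ : Measure Ω}
    [IsProbabilityMeasure μ] {n : ℕ} {A : Ω → Matrix (Fin n) (Fin n) ℝ} {κ : ℝ}
    (h : matrixBiggestJump μ A < κ) (i j : Fin n) (x : ℝ) :
    μ {ω | A ω i j = x} ≤ ENNReal.ofReal κ := by
  have hb : BddAbove (Set.range fun x : ℝ => μ.real {ω | A ω i j = x}) :=
    ⟨1, by rintro _ ⟨x, rfl⟩; exact measureReal_le_one⟩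
  have h1 : μ.real {ω | A ω i j = x} ≤ biggestJump μ (fun ω => A ω i j) := le_ciSup hb x
  have h2 : biggestJump μ (fun ω => A ω i j) ≤ matrixBiggestJump μ A :=
    le_ciSup (f := fun p : Fin n × Fin n => biggestJump μ (fun ω => A ω p.1 p.2))
      (Set.finite_range _).bddAbove (i, j)
  rw [ENNReal.le_ofReal_iff_toReal_le (measure_ne_top _ _)]
  · exact (h1.trans h2).trans h.le
  · exact measureReal_nonneg.trans ((h1.trans h2).trans h.le)

lemma measureReal_le_of_le_ofReal {Ω : Type*} [MeasurableSpace Ω] {μ : Measure Ω} {s : Set Ω}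
    {c : ℝ} (hc : 0 ≤ c) (h : μ s ≤ ENNReal.ofReal c) : μ.real s ≤ c :=
  (ENNReal.toReal_mono ENNReal.ofReal_ne_top h).trans (ENNReal.toReal_ofReal hc).le

theorem mainTheorem1 :
    (∀ κ : ℝ, 0 ≤ κ → κ < 1 →
      ∃ C : ℝ, 0 < C ∧
        ∀ (n : ℕ), 1 ≤ n →
        ∀ (Ω : Type u) [MeasurableSpace Ω] (μ : Measure Ω) [IsProbabilityMeasure μ]
          (G : Ω → Matrix (Fin n) (Fin n) ℝ),
          IsGinibreMatrix μ G → matrixBiggestJump μ G < κ →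
          μ.real {ω | (G ω).rank < n} ≤ C * (n : ℝ) ^ (-(1 / 2) : ℝ)) ∧
    (∀ κ : ℝ, 0 ≤ κ → κ < 1 → ∀ ε : ℝ, 0 < ε → ε < 1 →
      ∃ C : ℝ, 0 < C ∧
        ∀ (n : ℕ), 1 ≤ n →
        ∀ (Ω : Type u) [MeasurableSpace Ω] (μ : Measure Ω) [IsProbabilityMeasure μ]
          (W : Ω → Matrix (Fin n) (Fin n) ℝ),
          IsWignerMatrix μ W → matrixBiggestJump μ W < κ →
          μ.real {ω | (W ω).rank < n} ≤ C * (n : ℝ) ^ (-((1 - ε) / 4) : ℝ)) := by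
  constructor
  · intro κ hκ0 hκ1
    obtain ⟨C, hC, h⟩ := exists_measure_exists_left_ker_le hκ0 hκ1
    refine ⟨C, hC, ?_⟩
    intro n hn Ω _ μ _ G hG hκ
    have h1 := h (X := fun i j ω => G ω i j) hn hG.indep hG.measurable_entry
      (measure_eq_le_of_matrixBiggestJump_lt hκ)
    have hsub : {ω | (G ω).rank < n} ⊆
        {ω | ∃ v : Fin n → ℝ, v ≠ 0 ∧ ∀ j, ∑ i, G ω i j * v i = 0} := by
      intro ω hω
      have h2 : nullity (G ω).transpose ≠ 0 := by
        have e : (Matrix.of (G ω).transpose).rank = (G ω).rank := Matrix.rank_transpose _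
        have hω' : (G ω).rank < n := hω
        unfold nullity
        rw [e]
        omega
      exact nullity_ne_zero_iff.mp h2
    refine (measureReal_le_of_le_ofReal (by positivity)
      ((measure_mono hsub).trans h1)).trans (le_of_eq ?_)
    rw [Real.rpow_neg (by positivity), Real.sqrt_eq_rpow, div_eq_mul_inv]
  · intro κ hκ0 hκ1 ε hε0 hε1
    obtain ⟨C, hC, h⟩ := exists_measure_nullity_ne_zero_le hκ0 hκ1
    refine ⟨C, hC, ?_⟩
    intro n hn Ω _ μ _ W hW hκ
    -- symmetrise on the null set where `W` is not symmetric
    let W' : Ω → Fin n → Fin n → ℝ := fun ω i j =>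
      W ω (upperPosition i j).1.1 (upperPosition i j).1.2
    have hup : ∀ p : {p : Fin n × Fin n // p.1 ≤ p.2}, upperPosition p.1.1 p.1.2 = p := by
      rintro ⟨⟨i, j⟩, hij⟩
      have hij' : i ≤ j := hij
      simp [upperPosition, hij']
    have hW' : IsSymmetricIndep μ κ W' :=
      { measurable_entry := fun i j => hW.measurable_entry _ _
        symm := fun ω i j => by simp only [W', upperPosition, min_comm i j, max_comm i j]
        indep := by
          simp only [W', hup]
          exact hW.indep
        atom_le := fun i j x => measure_eq_le_of_matrixBiggestJump_lt hκ _ _ x }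
    have hle : μ {ω | (W ω).rank < n} ≤ μ {ω | nullity (W' ω) ≠ 0} := by
      refine measure_mono_ae ?_
      filter_upwards [hW.symm] with ω hs hω
      have e : W' ω = W ω := by
        ext i j
        rcases le_total i j with hij | hij
        · simp [W', upperPosition, hij]
        · simpa [W', upperPosition, hij] using hs.apply i j
      have hω' : (W ω).rank < n := hω
      change nullity (W' ω) ≠ 0
      rw [e]
      change n - (W ω).rank ≠ 0
      omega
    have hnR : (1 : ℝ) ≤ n := by exact_mod_cast hn
    refine (measureReal_le_of_le_ofReal (by positivity) (hle.trans (h n W' hW'))).trans ?_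
    rw [div_eq_mul_inv]
    gcongr
    have e : (√√((n : ℝ) + 1))⁻¹ = ((n : ℝ) + 1) ^ (-(1 / 4) : ℝ) := by
      rw [Real.sqrt_eq_rpow, Real.sqrt_eq_rpow, ← Real.rpow_mul (by positivity),
        Real.rpow_neg (by positivity)]
      norm_num
    rw [e]
    calc ((n : ℝ) + 1) ^ (-(1 / 4) : ℝ) ≤ (n : ℝ) ^ (-(1 / 4) : ℝ) :=
          Real.rpow_le_rpow_of_nonpos (by linarith) (by linarith) (by norm_num)
      _ ≤ (n : ℝ) ^ (-((1 - ε) / 4) : ℝ) :=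
          Real.rpow_le_rpow_of_exponent_le hnR (by linarith)
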